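/- Let $F$ be a finite extension of $\mathbb{Q}_p$ ($p=2$ allowed) with valuation ring $\mathfrak o$, maximal ideal $\mathfrak p$ and uniformizer $\varpi$. Let $n\ge 0$, and let $V_n$ be the quadratic space over $F$ with ordered basis $e_{-n},\dots,e_{-1},e_0,e_1,\dots,e_n$ and Gram matrix $$\begin{pmatrix}&&J_n\\&2&\\J_n&&\end{pmatrix},\qquad J_n=\sum_{i=1}^nE^n_{i,n+1-i},$$ where $E^n_{i,j}$ are the $n\times n$ matrix units; $\mathrm{SO}_{2n+1}(F)$ is its special orthogonal group, realized as a group of matrices. For $m\ge0$ let $$L_m=\bigoplus_{i=1}^n\mathfrak o e_{-i}\oplus\mathfrak p^m e_0\oplus\bigoplus_{i=1}^n\mathfrak p^m e_i ,$$ let $J_{n,m}$ be the stabilizer of $L_m$ in $\mathrm{SO}_{2n+1}(F)$, put $K_{n,0}=J_{n,0}$, and for $m\ge1$ let $K_{n,m}$ be the subgroup of those $g\in J_{n,m}$ whose action on $L_m/(\mathfrak p^m e_0+\mathfrak p^mL_m)\simeq(\mathfrak o/\mathfrak p^m)^{2n}$ lies in $\mathrm{SO}_{2n}(\mathfrak o/\mathfrak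 p^m)$; explicitly, $g\in K_{n,m}$ if and only if $g\in J_{n,m}$ and the determinant of the matrix obtained from $g$ by deleting the row and column of $e_0$ is congruent to $1$ modulo $2\mathfrak p^m$. For $1\le i<j\le n$ and $y\in F$ let $$x_{\epsilon_i+\epsilon_j}(y)=\begin{pmatrix}I_n&&y(E^n_{i,n+1-j}-E^n_{j,n+1-i})\\&1&\\&&I_n\end{pmatrix}.$$ For $1\le j\le n$ let $w_{\epsilon_j,m}\in \mathrm{SO}_{2n+1}(F)$ be the element with $e_{n+1-j}\mapsto-\varpi^{-m}e_{-n-1+j}$, $e_{-n-1+j}\mapsto-\varpi^{m}e_{n+1-j}$, $e_0\mapsto-e_0$, fixing all other basis vectors. For $S\subseteq\{1,\dots,n\}$ put $$w_{S,m}=\prod_{j\in S}w_{\epsilon_j,m},\qquad I_S=\{\epsilon_i+\epsilon_j\mid 1\le i<j\le n,\ i\notin S\}.$$ Proposition 4.1. For every $m\ge0$, the elements $$w_{S,m+1}\prod_{\beta\in I_S}x_\beta(\varpi^{-m-1}y_{S,\beta}),$$ where $S$ runs over the subsets of $\{1,\dots,n\}$ with $|S|$ even and $(y_{S,\beta})_{\beta\in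 I_S}$ over all families in $\mathfrak o/\mathfrak p$ (each $y_{S,\beta}$ being replaced by an arbitrary lift to $\mathfrak o$), form a complete set of representatives of the left cosets $$K_{n,m+1}/(K_{n,m}\cap K_{n,m+1}):$$ they all lie in $K_{n,m+1}$, and every left coset contains exactly one of them, distinct data $(S,(y_{S,\beta})_\beta)$ giving distinct cosets. -/

import Mathlib

open scoped ValuativeRel

namespace OddOrthogonal

/-! ### The split odd special orthogonal group -/

/-- Positions of the ordered basis `e_{-n}, …, e_{-1}, e_0, e_1, …, e_n`: the three blocks have
sizes `n`, `1`, `n`. Indices `1, …, n` are represented by `Fin n` (so `i` here is `i + 1` there). -/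
abbrev Idx (n : ℕ) : Type := Fin n ⊕ Unit ⊕ Fin n

/-- The `i`-th vector of the first block, i.e. `e_{-n-1+i}` for `1 ≤ i ≤ n`. -/
def neg {n : ℕ} (i : Fin n) : Idx n := Sum.inl i

/-- The position of the middle vector `e_0`. -/
def zero {n : ℕ} : Idx n := Sum.inr (Sum.inl ())

/-- The `(n+1-i)`-th vector of the last block, i.e. `e_{n+1-i}` for `1 ≤ i ≤ n`; it is the vector
dual to `e_{-n-1+i}`. -/
def pos {n : ℕ} (i : Fin n) : Idx n := Sum.inr (Sum.inr i.rev)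

section Group

variable (n : ℕ) (F : Type*) [Field F]

/-- The Gram matrix with blocks `J_n`, `2`, `J_n` on the antidiagonal, where `J_n` has ones on its
antidiagonal. -/
def gram : Matrix (Idx n) (Idx n) F :=
  Matrix.of fun a b =>
    match a, b with
    | Sum.inl i, Sum.inr (Sum.inr j) => if j = i.rev then 1 else 0
    | Sum.inr (Sum.inl _), Sum.inr (Sum.inl _) => 2
    | Sum.inr (Sum.inr i), Sum.inl j => if j = i.rev then 1 else 0
    | _, _ => 0

/-- `SO_{2n+1}(F)`. -/
def SO : Subgroup (GL (Idx n) F) where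
  carrier := {g | (g : Matrix (Idx n) (Idx n) F).det = 1 ∧
    (g : Matrix (Idx n) (Idx n) F).transpose * gram n F * (g : Matrix (Idx n) (Idx n) F)
      = gram n F}
  one_mem' := by simp
  mul_mem' := by
    rintro g h ⟨hg, hg'⟩ ⟨hh, hh'⟩
    refine ⟨by simp [hg, hh], ?_⟩
    simp only [Units.val_mul, Matrix.transpose_mul]
    calc _ = (h : Matrix (Idx n) (Idx n) F).transpose *
          ((g : Matrix (Idx n) (Idx n) F).transpose * gram n F * g) * h := by
            simp only [Matrix.mul_assoc]
      _ = _ := by rw [hg', hh']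
  inv_mem' := by
    rintro g ⟨hg, hg'⟩
    have h1 : (g : Matrix (Idx n) (Idx n) F) * (g⁻¹ : GL (Idx n) F) = 1 := by
      rw [← Units.val_mul]; simp
    refine ⟨?_, ?_⟩
    · have := congrArg Matrix.det h1
      rw [Matrix.det_mul, hg, one_mul, Matrix.det_one] at this
      exact this
    · have h2 : ((g⁻¹ : GL (Idx n) F) : Matrix (Idx n) (Idx n) F).transpose *
          (g : Matrix (Idx n) (Idx n) F).transpose = 1 := by
        rw [← Matrix.transpose_mul, h1, Matrix.transpose_one]
      calc _ = ((g⁻¹ : GL (Idx n) F) : Matrix (Idx n) (Idx n) F).transpose *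
            ((g : Matrix (Idx n) (Idx n) F).transpose * gram n F * g) * (g⁻¹ : GL (Idx n) F) := by
              rw [hg']
        _ = (((g⁻¹ : GL (Idx n) F) : Matrix (Idx n) (Idx n) F).transpose *
            (g : Matrix (Idx n) (Idx n) F).transpose) * gram n F *
              ((g : Matrix (Idx n) (Idx n) F) * (g⁻¹ : GL (Idx n) F)) := by
              simp only [Matrix.mul_assoc]
        _ = _ := by rw [h1, h2, Matrix.one_mul, Matrix.mul_one]

variable {n F}

/-- The determinant of the `2n × 2n` matrix obtained by deleting the row and the column of `e_0`. -/
def hypDet (g : GL (Idx n) F) : F :=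
  ((g : Matrix (Idx n) (Idx n) F).toSquareBlockProp (fun a => a ≠ zero)).det

theorem det_updateRow_zero (A : Matrix (Idx n) (Idx n) F) :
    (A.updateRow zero (Pi.single zero 1)).det =
      (A.toSquareBlockProp (fun a => a ≠ zero)).det := by
  rw [Matrix.twoBlockTriangular_det _ (fun a : Idx n => a ≠ zero)]
  · have h1 : ((A.updateRow zero (Pi.single zero 1)).toSquareBlockProp
        (fun a : Idx n => ¬ a ≠ zero)).det = 1 := by
      have : ((A.updateRow zero (Pi.single zero 1)).toSquareBlockProp
        (fun a : Idx n => ¬ a ≠ zero)) = 1 := by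
        ext ⟨a, ha⟩ ⟨b, hb⟩
        obtain rfl : a = zero := not_not.mp ha
        obtain rfl : b = zero := not_not.mp hb
        simp [Matrix.toSquareBlockProp]
      rw [this, Matrix.det_one]
    rw [h1, mul_one]
    congr 1
    ext ⟨a, ha⟩ ⟨b, hb⟩
    simp [Matrix.toSquareBlockProp, Matrix.updateRow_ne ha]
  · intro i hi j hj
    obtain rfl : i = zero := not_not.mp hi
    simp [Matrix.updateRow_self, hj]

/-- Entries of the inverse of an element of `SO_{2n+1}(F)`. -/
theorem gram_mul_eq {g : GL (Idx n) F} (hg : g ∈ SO n F) :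
    gram n F * (g : Matrix (Idx n) (Idx n) F) =
      ((g⁻¹ : GL (Idx n) F) : Matrix (Idx n) (Idx n) F).transpose * gram n F := by
  have h1 : (g : Matrix (Idx n) (Idx n) F) * (g⁻¹ : GL (Idx n) F) = 1 := by
    rw [← Units.val_mul]; simp
  have h2 : ((g⁻¹ : GL (Idx n) F) : Matrix (Idx n) (Idx n) F).transpose *
      (g : Matrix (Idx n) (Idx n) F).transpose = 1 := by
    rw [← Matrix.transpose_mul, h1, Matrix.transpose_one]
  conv_rhs => rw [← hg.2]
  rw [← Matrix.mul_assoc, ← Matrix.mul_assoc, h2, Matrix.one_mul]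

theorem mul_gram_zero (M : Matrix (Idx n) (Idx n) F) (a : Idx n) :
    (M * gram n F) a zero = M a zero * 2 := by
  simp [Matrix.mul_apply, gram, zero, Fintype.sum_sum_type]

theorem gram_mul_zero (M : Matrix (Idx n) (Idx n) F) (b : Idx n) :
    (gram n F * M) zero b = 2 * M zero b := by
  simp [Matrix.mul_apply, gram, zero, Fintype.sum_sum_type]

theorem gram_mul_neg (M : Matrix (Idx n) (Idx n) F) (i : Fin n) (b : Idx n) :
    (gram n F * M) (neg i) b = M (pos i) b := by
  simp [Matrix.mul_apply, gram, neg, pos, Fintype.sum_sum_type]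

theorem gram_mul_pos (M : Matrix (Idx n) (Idx n) F) (i : Fin n) (b : Idx n) :
    (gram n F * M) (pos i) b = M (neg i) b := by
  simp [Matrix.mul_apply, gram, neg, pos, Fintype.sum_sum_type]

theorem apply_pos_zero {g : GL (Idx n) F} (hg : g ∈ SO n F) (i : Fin n) :
    g (pos i) zero = 2 * (g⁻¹ : GL (Idx n) F) zero (neg i) := by
  have h := congrFun (congrFun (gram_mul_eq hg) (neg i)) zero
  rw [gram_mul_neg, mul_gram_zero, Matrix.transpose_apply] at h
  rw [h, mul_comm]

theorem apply_neg_zero {g : GL (Idx n) F} (hg : g ∈ SO n F) (i : Fin n) :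
    g (neg i) zero = 2 * (g⁻¹ : GL (Idx n) F) zero (pos i) := by
  have h := congrFun (congrFun (gram_mul_eq hg) (pos i)) zero
  rw [gram_mul_pos, mul_gram_zero, Matrix.transpose_apply] at h
  rw [h, mul_comm]

theorem inv_zero_zero [CharZero F] {g : GL (Idx n) F} (hg : g ∈ SO n F) :
    (g⁻¹ : GL (Idx n) F) zero zero = g zero zero := by
  have h := congrFun (congrFun (gram_mul_eq hg) zero) zero
  rw [gram_mul_zero, mul_gram_zero, Matrix.transpose_apply, mul_comm] at h
  exact (mul_right_cancel₀ two_ne_zero h).symm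

/-- On `SO_{2n+1}(F)` the complementary minor `hypDet` is the entry at `e_0`. -/
theorem hypDet_eq [CharZero F] {g : GL (Idx n) F} (hg : g ∈ SO n F) :
    hypDet g = g zero zero := by
  rw [hypDet, ← det_updateRow_zero, ← Matrix.adjugate_apply, ← inv_zero_zero hg,
    Matrix.coe_units_inv, Matrix.inv_def, hg.1]
  simp

end Group

/-! ### Root elements and Weyl elements -/

section Elements

variable {n : ℕ} {F : Type*} [Field F]

/-- `y (E_{i,n+1-j} - E_{j,n+1-i})`, placed in the upper right `n × n` block. -/
def rootMat (i j : Fin n) (y : F) : Matrix (Idx n) (Idx n) F :=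
  Matrix.single (neg i) (pos j) y - Matrix.single (neg j) (pos i) y

theorem pos_ne_neg (i j : Fin n) : (pos i : Idx n) ≠ neg j := by simp [pos, neg]

theorem rootMat_mul_rootMat (i j k l : Fin n) (y z : F) :
    rootMat i j y * rootMat k l z = 0 := by
  simp [rootMat, mul_sub, sub_mul, Matrix.single_mul_single_of_ne, pos_ne_neg]

theorem rootMat_neg (i j : Fin n) (y : F) : rootMat i j (-y) = -rootMat i j y := by
  ext a b
  simp [rootMat, Matrix.single_apply]
  split_ifs <;> simp

/-- The element `x_{ε_i + ε_j}(y)` of the root subgroup of `ε_i + ε_j`. -/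
def rootElt (i j : Fin n) (y : F) : GL (Idx n) F where
  val := 1 + rootMat i j y
  inv := 1 + rootMat i j (-y)
  val_inv := by
    rw [mul_add, add_mul, add_mul, rootMat_mul_rootMat, rootMat_neg]; simp
  inv_val := by
    rw [mul_add, add_mul, add_mul, rootMat_mul_rootMat, rootMat_neg]; simp

theorem rootElt_commute (i j k l : Fin n) (y z : F) :
    Commute (rootElt i j y) (rootElt k l z) := by
  apply Units.ext
  change (1 + rootMat i j y) * (1 + rootMat k l z) = (1 + rootMat k l z) * (1 + rootMat i j y)
  rw [mul_add, add_mul, add_mul, rootMat_mul_rootMat, mul_add, add_mul, add_mul,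
    rootMat_mul_rootMat]
  simp only [mul_one, one_mul, add_zero]
  abel

/-- The matrix of the linear map `e_b ↦ c_b e_{σ b}`. -/
def monomial (σ : Equiv.Perm (Idx n)) (c : Idx n → F) : Matrix (Idx n) (Idx n) F :=
  Matrix.of fun a b => if a = σ b then c b else 0

theorem monomial_apply_eq {σ : Equiv.Perm (Idx n)} {c : Idx n → F} {a b : Idx n}
    (h : a = σ b) : monomial σ c a b = c b := if_pos h

theorem monomial_apply_ne {σ : Equiv.Perm (Idx n)} {c : Idx n → F} {a b : Idx n}
    (h : a ≠ σ b) : monomial σ c a b = 0 := if_neg h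

theorem monomial_mul (σ τ : Equiv.Perm (Idx n)) (c d : Idx n → F) :
    monomial σ c * monomial τ d = monomial (σ * τ) (fun b => c (τ b) * d b) := by
  ext a b
  rw [Matrix.mul_apply, Finset.sum_eq_single (τ b)]
  · rw [monomial_apply_eq (σ := τ) rfl]
    by_cases h : a = σ (τ b)
    · rw [monomial_apply_eq h, monomial_apply_eq (σ := σ * τ) h]
    · rw [monomial_apply_ne h, monomial_apply_ne (σ := σ * τ) h, zero_mul]
  · intro x _ hx
    rw [monomial_apply_ne (σ := τ) hx, mul_zero]
  · simp

theorem monomial_one : monomial (1 : Equiv.Perm (Idx n)) (fun _ => (1 : F)) = 1 := by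
  ext a b
  by_cases h : a = b
  · subst h
    rw [monomial_apply_eq (σ := 1) (a := a) (b := a) rfl, Matrix.one_apply_eq]
  · rw [monomial_apply_ne (σ := 1) h, Matrix.one_apply_ne h]

/-- The coefficients of `w_{ε_j, m}`, with `t = ϖ^m`. -/
def weylCoeff (j : Fin n) (t : Fˣ) (b : Idx n) : F :=
  if b = pos j then -(t : F)⁻¹
  else if b = neg j then -(t : F)
  else if b = zero then -1
  else 1

theorem pos_inj {i j : Fin n} : (pos i : Idx n) = pos j ↔ i = j := by simp [pos]

theorem neg_inj {i j : Fin n} : (neg i : Idx n) = neg j ↔ i = j := by simp [neg]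

theorem neg_ne_pos (i j : Fin n) : (neg i : Idx n) ≠ pos j := by simp [pos, neg]

theorem zero_ne_pos (j : Fin n) : (zero : Idx n) ≠ pos j := by simp [pos, zero]

theorem zero_ne_neg (j : Fin n) : (zero : Idx n) ≠ neg j := by simp [neg, zero]

theorem pos_ne_zero (j : Fin n) : (pos j : Idx n) ≠ zero := by simp [pos, zero]

theorem neg_ne_zero (j : Fin n) : (neg j : Idx n) ≠ zero := by simp [neg, zero]

/-- Every position is one of `neg i`, `zero`, `pos i`. -/
theorem idx_cases (a : Idx n) : (∃ i, a = neg i) ∨ a = zero ∨ ∃ i, a = pos i := by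
  rcases a with i | ⟨⟨⟩⟩ | i
  · exact Or.inl ⟨i, rfl⟩
  · exact Or.inr (Or.inl rfl)
  · exact Or.inr (Or.inr ⟨i.rev, by simp [pos]⟩)

theorem sum_idx (f : Idx n → F) :
    ∑ a, f a = f zero + ((∑ i, f (neg i)) + ∑ i, f (pos i)) := by
  have : ∑ i : Fin n, f (pos i) = ∑ i : Fin n, f (Sum.inr (Sum.inr i)) :=
    Equiv.sum_comp Fin.revPerm (fun i : Fin n => f (Sum.inr (Sum.inr i)))
  rw [this, Fintype.sum_sum_type, Fintype.sum_sum_type]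
  simp only [neg, zero, Finset.univ_unique, Finset.sum_singleton]
  change _ + (f (Sum.inr (Sum.inl ())) + _) = _
  ring

/-- With `t = ϖ^m` this is the matrix of `w_{ε_j, m}`: it sends `e_{n+1-j} ↦ -t⁻¹ e_{-n-1+j}`,
`e_{-n-1+j} ↦ -t e_{n+1-j}`, `e_0 ↦ -e_0` and fixes the other basis vectors. -/
def weylMat (j : Fin n) (t : Fˣ) : Matrix (Idx n) (Idx n) F :=
  monomial (Equiv.swap (neg j) (pos j)) (weylCoeff j t)

theorem weylMat_mul_self (j : Fin n) (t : Fˣ) : weylMat j t * weylMat j t = 1 := by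
  rw [weylMat, monomial_mul, Equiv.swap_mul_self, ← monomial_one]
  congr 1
  funext b
  rcases idx_cases b with ⟨i, rfl⟩ | rfl | ⟨i, rfl⟩
  · by_cases h : i = j
    · subst h
      simp [weylCoeff, neg_ne_pos]
    · rw [Equiv.swap_apply_of_ne_of_ne (by simpa [neg_inj] using h) (neg_ne_pos _ _)]
      simp [weylCoeff, neg_ne_pos, neg_inj, h, neg_ne_zero]
  · rw [Equiv.swap_apply_of_ne_of_ne (zero_ne_neg _) (zero_ne_pos _)]
    simp [weylCoeff, zero_ne_neg, zero_ne_pos]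
  · by_cases h : i = j
    · subst h
      simp [weylCoeff, neg_ne_pos]
    · rw [Equiv.swap_apply_of_ne_of_ne (pos_ne_neg _ _) (by simpa [pos_inj] using h)]
      simp [weylCoeff, pos_ne_neg, pos_inj, h, pos_ne_zero]

/-- The Weyl element `w_{ε_j, m}`, for `t = ϖ^m`. -/
def weylElt (j : Fin n) (t : Fˣ) : GL (Idx n) F where
  val := weylMat j t
  inv := weylMat j t
  val_inv := weylMat_mul_self j t
  inv_val := weylMat_mul_self j t

theorem weylElt_commute (j k : Fin n) (t : Fˣ) : Commute (weylElt j t) (weylElt k t) := by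
  by_cases hjk : j = k
  · subst hjk
    exact Commute.refl _
  have hkj : k ≠ j := fun h => hjk h.symm
  apply Units.ext
  change weylMat j t * weylMat k t = weylMat k t * weylMat j t
  have hsw : ∀ b : Idx n, Equiv.swap (neg j) (pos j) (Equiv.swap (neg k) (pos k) b) =
      Equiv.swap (neg k) (pos k) (Equiv.swap (neg j) (pos j) b) := by
    intro b
    have hn : (neg j : Idx n) ≠ neg k := by simpa [neg_inj] using hjk
    have hp : (pos j : Idx n) ≠ pos k := by simpa [pos_inj] using hjk
    have h1 := neg_ne_pos j k
    have h2 := pos_ne_neg j k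
    simp only [Equiv.swap_apply_def]
    split_ifs <;> simp_all
  rw [weylMat, weylMat, monomial_mul, monomial_mul]
  congr 1
  · exact Equiv.ext hsw
  · funext b
    rcases idx_cases b with ⟨i, rfl⟩ | rfl | ⟨i, rfl⟩
    · by_cases h : i = j
      · subst h
        simp [Equiv.swap_apply_def, weylCoeff, neg_ne_pos, neg_inj, pos_inj, pos_ne_neg, hjk,
          pos_ne_zero, neg_ne_zero]
      · by_cases h' : i = k
        · subst h'
          simp [Equiv.swap_apply_def, weylCoeff, neg_ne_pos, neg_inj, pos_inj, pos_ne_neg, h,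
            pos_ne_zero, neg_ne_zero]
        · simp [Equiv.swap_apply_def, weylCoeff, neg_ne_pos, neg_inj, h, h']
    · simp [Equiv.swap_apply_def, weylCoeff, zero_ne_neg, zero_ne_pos]
    · by_cases h : i = j
      · subst h
        simp [Equiv.swap_apply_def, weylCoeff, neg_ne_pos, neg_inj, pos_inj, pos_ne_neg, hjk,
          pos_ne_zero, neg_ne_zero]
      · by_cases h' : i = k
        · subst h'
          simp [Equiv.swap_apply_def, weylCoeff, neg_ne_pos, neg_inj, pos_inj, pos_ne_neg, h,
            pos_ne_zero, neg_ne_zero]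
        · simp [Equiv.swap_apply_def, weylCoeff, pos_ne_neg, pos_inj, h, h']

/-- `w_{S,m} = ∏_{j ∈ S} w_{ε_j,m}` (the factors commute). -/
noncomputable def weylS (ϖ : Fˣ) (m : ℕ) (S : Finset (Fin n)) : GL (Idx n) F :=
  S.noncommProd (fun j => weylElt j (ϖ ^ m)) (fun _ _ _ _ _ => weylElt_commute _ _ _)

/-- The set `I_S` of the roots `ε_i + ε_j` with `i < j` and `i ∉ S`; the root `ε_i + ε_j` is
represented by the pair `(i, j)`. -/
def rootSet (S : Finset (Fin n)) : Finset (Fin n × Fin n) :=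
  Finset.univ.filter fun β => β.1 < β.2 ∧ β.1 ∉ S

/-- `∏_{β ∈ I_S} x_β(c_β)` (the factors commute). -/
noncomputable def rootProd (S : Finset (Fin n)) (c : rootSet S → F) : GL (Idx n) F :=
  Finset.univ.noncommProd (fun β : rootSet S => rootElt β.1.1 β.1.2 (c β))
    (fun _ _ _ _ _ => rootElt_commute _ _ _ _ _ _)

end Elements

/-! ### The open compact subgroups -/

section Compact

variable (n : ℕ) (F : Type*) [Field F] [ValuativeRel F]

/-- `𝔭^m` as an `𝔬`-submodule of `F`. -/
noncomputable def pPow (m : ℕ) : Submodule 𝒪[F] F :=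
  Submodule.map (Algebra.linearMap 𝒪[F] F) (𝓂[F] ^ m)

/-- The lattice `L_m = ⊕_{i ≥ 1} 𝔬 e_{-i} ⊕ 𝔭^m e_0 ⊕ ⊕_{i ≥ 1} 𝔭^m e_i`, in coordinates. -/
noncomputable def lattice (m : ℕ) : Submodule 𝒪[F] (Idx n → F) where
  carrier := {v | (∀ i, v (neg i) ∈ 𝒪[F]) ∧ v zero ∈ pPow F m ∧ ∀ i, v (pos i) ∈ pPow F m}
  zero_mem' := ⟨fun _ => Subring.zero_mem _, Submodule.zero_mem _, fun _ => Submodule.zero_mem _⟩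
  add_mem' := fun h h' => ⟨fun i => Subring.add_mem _ (h.1 i) (h'.1 i),
    Submodule.add_mem _ h.2.1 h'.2.1, fun i => Submodule.add_mem _ (h.2.2 i) (h'.2.2 i)⟩
  smul_mem' := fun c _ h => ⟨fun i => Subring.mul_mem _ c.2 (h.1 i),
    Submodule.smul_mem _ c h.2.1, fun i => Submodule.smul_mem _ c (h.2.2 i)⟩

/-- `J_{n,m}`: the stabilizer of `L_m` in `SO_{2n+1}(F)`. -/
noncomputable def J (m : ℕ) : Subgroup (GL (Idx n) F) where
  carrier := {g | g ∈ SO n F ∧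
    ∀ v, (g : Matrix (Idx n) (Idx n) F).mulVec v ∈ lattice n F m ↔ v ∈ lattice n F m}
  one_mem' := ⟨Subgroup.one_mem _, by simp⟩
  mul_mem' := by
    rintro g h ⟨hg, hg'⟩ ⟨hh, hh'⟩
    refine ⟨Subgroup.mul_mem _ hg hh, fun v => ?_⟩
    rw [Units.val_mul, ← Matrix.mulVec_mulVec, hg', hh']
  inv_mem' := by
    rintro g ⟨hg, hg'⟩
    refine ⟨Subgroup.inv_mem _ hg, fun v => ?_⟩
    rw [← hg', Matrix.mulVec_mulVec, ← Units.val_mul]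
    simp

variable {n F}

theorem pPow_le (m : ℕ) {x : F} (hx : x ∈ pPow F m) : x ∈ 𝒪[F] := by
  obtain ⟨a, _, rfl⟩ := hx
  exact a.2

theorem mul_mem_pPow {m : ℕ} {x y : F} (hx : x ∈ 𝒪[F]) (hy : y ∈ pPow F m) :
    x * y ∈ pPow F m :=
  Submodule.smul_mem _ (⟨x, hx⟩ : 𝒪[F]) hy

theorem J_zero_neg {m : ℕ} {g : GL (Idx n) F} (hg : g ∈ J n F m) (i : Fin n) :
    g zero (neg i) ∈ pPow F m := by
  have h := ((hg.2 (Pi.single (neg i) 1)).2 ⟨fun j => ?_, ?_, fun j => ?_⟩).2.1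
  · simpa using h
  · by_cases hij : j = i
    · subst hij
      simp
    · rw [Pi.single_eq_of_ne (by simpa [neg_inj] using hij)]
      exact Subring.zero_mem _
  · rw [Pi.single_eq_of_ne (neg_ne_zero i).symm]
    exact Submodule.zero_mem _
  · rw [Pi.single_eq_of_ne (pos_ne_neg _ _)]
    exact Submodule.zero_mem _

theorem J_zero_pos {m : ℕ} {g : GL (Idx n) F} (hg : g ∈ J n F m) (i : Fin n) {t : F}
    (ht : t ∈ pPow F m) : g zero (pos i) * t ∈ pPow F m := by
  have h := ((hg.2 (Pi.single (pos i) t)).2 ⟨fun j => ?_, ?_, fun j => ?_⟩).2.1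
  · simpa using h
  · rw [Pi.single_eq_of_ne (neg_ne_pos _ _)]
    exact Subring.zero_mem _
  · rw [Pi.single_eq_of_ne (pos_ne_zero i).symm]
    exact Submodule.zero_mem _
  · by_cases hij : j = i
    · subst hij
      simpa using ht
    · rw [Pi.single_eq_of_ne (by simpa [pos_inj] using hij)]
      exact Submodule.zero_mem _

variable (n F)

/-- The open compact subgroup `K_{n,m}` of `SO_{2n+1}(F)`. One has `K_{n,0} = J_{n,0}`. For
`m ≥ 1` the group `J_{n,m}` acts on `L_m / (𝔭^m e_0 + 𝔭^m L_m) ≅ (𝔬/𝔭^m)^{2n}` preserving the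
reduction of the hyperbolic quadratic form `v ↦ ϖ^{-m} ⟨v, v⟩ / 2`, and `K_{n,m}` is the
preimage of the special orthogonal group `SO_{2n}(𝔬/𝔭^m)`. The determinant `hypDet g` of the
action on the coordinates other than `e_0` is congruent to `1` or `-1` modulo `2𝔭^m`, and `K_{n,m}`
is given by the sign `1`. If `2` is a unit this is the condition that the action
on `(𝔬/𝔭^m)^{2n}` has determinant `1`; if not, working modulo `2𝔭^m` instead of `𝔭^m`
means that the Dickson invariant (the class of `(1 - hypDet g) / 2`) vanishes. -/
noncomputable def K [CharZero F] (m : ℕ) : Subgroup (GL (Idx n) F) where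
  carrier := {g | g ∈ J n F m ∧ (0 < m → ∃ t ∈ pPow F m, hypDet g - 1 = 2 * t)}
  one_mem' := by
    refine ⟨Subgroup.one_mem _, fun _ => ⟨0, Submodule.zero_mem _, ?_⟩⟩
    rw [hypDet_eq (Subgroup.one_mem _)]
    simp
  mul_mem' := by
    rintro g h ⟨hg, hg'⟩ ⟨hh, hh'⟩
    refine ⟨Subgroup.mul_mem _ hg hh, fun hm => ?_⟩
    obtain ⟨s, hs, hs'⟩ := hg' hm
    obtain ⟨t, ht, ht'⟩ := hh' hm
    have hi := Subgroup.inv_mem _ hh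
    rw [hypDet_eq hg.1] at hs'
    rw [hypDet_eq hh.1] at ht'
    rw [hypDet_eq (Subgroup.mul_mem _ hg.1 hh.1)]
    refine ⟨s + t + 2 * (s * t) +
      ((∑ i, g zero (neg i) * (h⁻¹ : GL (Idx n) F) zero (pos i)) +
        ∑ i, g zero (pos i) * (h⁻¹ : GL (Idx n) F) zero (neg i)), ?_, ?_⟩
    · refine Submodule.add_mem _ (Submodule.add_mem _ (Submodule.add_mem _ hs ht) ?_)
        (Submodule.add_mem _ (Submodule.sum_mem _ fun i _ => ?_)
          (Submodule.sum_mem _ fun i _ => ?_))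
      · rw [two_mul]
        exact Submodule.add_mem _ (mul_mem_pPow (pPow_le m hs) ht)
          (mul_mem_pPow (pPow_le m hs) ht)
      · rw [mul_comm]
        exact J_zero_pos hi i (J_zero_neg hg i)
      · exact J_zero_pos hg i (J_zero_neg hi i)
    · have hs2 : g zero zero = 1 + 2 * s := by rw [← hs']; ring
      have ht2 : h zero zero = 1 + 2 * t := by rw [← ht']; ring
      rw [Units.val_mul, Matrix.mul_apply, sum_idx]
      simp only [apply_pos_zero hh.1, apply_neg_zero hh.1]
      rw [hs2, ht2]
      simp only [mul_left_comm _ (2 : F), ← Finset.mul_sum]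
      ring
  inv_mem' := by
    rintro g ⟨hg, hg'⟩
    refine ⟨Subgroup.inv_mem _ hg, fun hm => ?_⟩
    rw [hypDet_eq (Subgroup.inv_mem _ hg.1), inv_zero_zero hg.1, ← hypDet_eq hg.1]
    exact hg' hm

end Compact

/-! ### Uniformizers and the coset representatives -/

section Representatives

variable {n : ℕ} {F : Type*} [Field F] [ValuativeRel F]

/-- `ϖ` is a uniformizer: a generator of `𝔭`. -/
def IsUniformizer (ϖ : Fˣ) : Prop :=
  ∃ π : 𝒪[F], 𝓂[F] = Ideal.span {π} ∧ (π : F) = ϖ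

/-- The labels `(S, (y_{S,β})_{β ∈ I_S})` with `S ⊆ {1, …, n}`, `|S|` even and
`y_{S,β} ∈ 𝔬/𝔭`. -/
abbrev Label (n : ℕ) (F : Type*) [Field F] [ValuativeRel F] : Type _ :=
  (S : {S : Finset (Fin n) // Even S.card}) × (rootSet S.1 → 𝓀[F])

/-- The element `w_{S,m+1} ∏_{β ∈ I_S} x_β(ϖ^{-m-1} y_β)`, for `y_β ∈ 𝔬`. -/
noncomputable def rep (ϖ : Fˣ) (m : ℕ) (S : Finset (Fin n)) (y : rootSet S → 𝒪[F]) :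
    GL (Idx n) F :=
  weylS ϖ (m + 1) S * rootProd S (fun β => ((ϖ : F) ^ (m + 1))⁻¹ * (y β : F))

end Representatives

end OddOrthogonal

/-!
Write `t = ϖ ^ (m + 1)`. The group `J_{n,m+1}` acts on the reduction
`L_{m+1} / (𝔭^{m+1} e_0 + 𝔭 L_{m+1})`, a split quadratic space of dimension `2n` over the residue
field, and an element of it belongs to `J_{n,m}` exactly when it stabilizes the Lagrangian subspace
which is the image of `𝔭 L_m` (`mem_J_iff_of_mem_J_succ`). So the cosets of `J_{n,m} ∩ J_{n,m+1}`
are described by Lagrangian subspaces: if `(b, D)` are the blocks of `t g` and `g` in the columns of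
`e_1, …, e_n` and the rows of `e_{-n}, …, e_{-1}` and `e_1, …, e_n`, the columns of `(b, D)` modulo
`𝔭` span the subspace belonging to `g`, and `g`, `h` lie in the same coset if and only if their
subspaces are orthogonal (`inv_mul_mem_J_iff`).

Every Lagrangian subspace has a unique reduced echelon basis (`IsLagrangian.exists_echelon`,
`echelon_unique`). Exactly one vector of each hyperbolic pair is a pivot, which gives the set `S`,
and the other entries form an alternating matrix supported on `I_S`. This is the basis given by the
columns of `w_{S,m+1} ∏ x_β(ϖ^{-m-1} y_β)` (`exists_hasCoords_rep`).

It remains to see that elements of `K_{n,m+1}` give sets `S` of even size. The entry of the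
representative at `e_0` is `(-1) ^ |S|`, and an element of `J_{n,m} ∩ J_{n,m+1}` has entry
congruent to `1` modulo `2𝔭` there (`exists_zero_zero_sub_one`). The congruence modulo `2𝔭`, and not
only `𝔭`, is needed in residue characteristic two; it comes from the exact formula for `hypDet` in
terms of a Schur complement that is a rank one perturbation of the identity
(`HasCoords.exists_hypDet_sub_one`).
-/

namespace OddOrthogonal

/-! ### Lagrangian subspaces of a split quadratic space -/

section Lagrangian

open Matrix

variable {n : ℕ}

section Ring

variable {R : Type*} [CommRing R]

/-- A pair `(b, D)` of `n × n` matrices stands for `n` vectors of the split quadratic space of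
dimension `2n`: the `j`-th columns of `b` and `D` are the coordinates of the `j`-th vector along
two complementary Lagrangian subspaces. `pairing b D b' D'` is the matrix of scalar products of
the vectors of `(b, D)` with those of `(b', D')`. -/
def pairing (b D b' D' : Matrix (Fin n) (Fin n) R) : Matrix (Fin n) (Fin n) R :=
  Dᵀ * b' + bᵀ * D'

/-- The first component of the image of `(b, D)` under the isometry that exchanges, with a sign,
the two dual coordinates of index `i` for each `i ∈ S`. -/
def flipNeg (S : Finset (Fin n)) (b D : Matrix (Fin n) (Fin n) R) : Matrix (Fin n) (Fin n) R :=
  Matrix.of fun i j => if i ∈ S then -D i j else b i j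

/-- The second component of the image of `(b, D)` under the isometry of `flipNeg`. -/
def flipPos (S : Finset (Fin n)) (b D : Matrix (Fin n) (Fin n) R) : Matrix (Fin n) (Fin n) R :=
  Matrix.of fun i j => if i ∈ S then -b i j else D i j

/-- Alternating matrices; the condition on the diagonal matters in characteristic two. -/
def IsAlternating (M : Matrix (Fin n) (Fin n) R) : Prop :=
  (∀ i, M i i = 0) ∧ ∀ i j, M j i = -M i j

theorem pairing_flip (S : Finset (Fin n)) (b D b' D' : Matrix (Fin n) (Fin n) R) :
    pairing (flipNeg S b D) (flipPos S b D) (flipNeg S b' D') (flipPos S b' D') =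
      pairing b D b' D' := by
  ext i j
  simp only [pairing, Matrix.add_apply, Matrix.mul_apply, ← Finset.sum_add_distrib]
  refine Finset.sum_congr rfl fun k _ => ?_
  by_cases h : k ∈ S
  · simp only [flipNeg, flipPos, h, Matrix.of_apply, Matrix.transpose_apply, if_true]
    ring
  · simp [flipNeg, flipPos, h]

theorem flipNeg_flip (S : Finset (Fin n)) (b D : Matrix (Fin n) (Fin n) R) :
    flipNeg S (flipNeg S b D) (flipPos S b D) = b := by
  ext i j
  by_cases h : i ∈ S <;> simp [flipNeg, flipPos, h]

theorem flipPos_flip (S : Finset (Fin n)) (b D : Matrix (Fin n) (Fin n) R) :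
    flipPos S (flipNeg S b D) (flipPos S b D) = D := by
  ext i j
  by_cases h : i ∈ S <;> simp [flipNeg, flipPos, h]

theorem IsAlternating.dotProduct_mulVec {M : Matrix (Fin n) (Fin n) R} (hM : IsAlternating M)
    (v : Fin n → R) : v ⬝ᵥ M *ᵥ v = 0 := by
  simp only [dotProduct, mulVec, Finset.mul_sum]
  rw [← Finset.sum_product']
  refine Finset.sum_involution (fun x _ => x.swap) ?_ ?_ (by simp) (by simp)
  · rintro ⟨i, j⟩ _
    simp only [Prod.swap]
    rw [hM.2 i j]
    ring
  · rintro ⟨i, j⟩ _ h h'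
    obtain rfl : j = i := congrArg Prod.fst h'
    exact h (by simp [hM.1])

theorem IsAlternating.conj {M : Matrix (Fin n) (Fin n) R} (hM : IsAlternating M)
    (P : Matrix (Fin n) (Fin n) R) : IsAlternating (Pᵀ * M * P) := by
  have hT : Mᵀ = -M := by ext i j; simpa using hM.2 i j
  refine ⟨fun i => ?_, fun i j => ?_⟩
  · have h := hM.dotProduct_mulVec (fun k => P k i)
    rw [Matrix.mul_assoc, Matrix.mul_apply]
    exact h
  · have h : (Pᵀ * M * P)ᵀ = -(Pᵀ * M * P) := by
      simp [Matrix.transpose_mul, hT, Matrix.mul_assoc]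
    exact congrFun (congrFun h i) j

end Ring

variable {k : Type*} [Field k]

/-- The columns of `(b, D)` form a basis of a Lagrangian subspace: the matrix `(b, D)` has a left
inverse, and the quadratic form `(x, y) ↦ x ⬝ᵥ y` vanishes on the span of the columns. -/
structure IsLagrangian (b D : Matrix (Fin n) (Fin n) k) : Prop where
  injective : ∀ u, b *ᵥ u = 0 → D *ᵥ u = 0 → u = 0
  alternating : IsAlternating (Dᵀ * b)

namespace IsLagrangian

variable {b D : Matrix (Fin n) (Fin n) k}

theorem dotProduct_eq_zero (h : IsLagrangian b D) (u v : Fin n → k) :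
    (D *ᵥ u) ⬝ᵥ (b *ᵥ v) + (b *ᵥ u) ⬝ᵥ (D *ᵥ v) = 0 := by
  have h1 : Dᵀ * b + bᵀ * D = 0 := by
    have : bᵀ * D = (Dᵀ * b)ᵀ := by simp
    rw [this]
    ext i j
    simp only [Matrix.add_apply, Matrix.transpose_apply, h.alternating.2 i j, Matrix.zero_apply]
    ring
  have h2 : ∀ P Q : Matrix (Fin n) (Fin n) k,
      (P *ᵥ u) ⬝ᵥ (Q *ᵥ v) = u ⬝ᵥ (Pᵀ * Q) *ᵥ v := fun P Q => by
    rw [← Matrix.mulVec_mulVec, Matrix.dotProduct_mulVec u, Matrix.vecMul_transpose]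
  rw [h2, h2, ← dotProduct_add, ← Matrix.add_mulVec, h1]
  simp

theorem flip (h : IsLagrangian b D) (S : Finset (Fin n)) :
    IsAlternating ((flipPos S b D)ᵀ * flipNeg S b D) := by
  constructor
  · intro i
    rw [← h.alternating.1 i]
    simp only [Matrix.mul_apply]
    refine Finset.sum_congr rfl fun k _ => ?_
    by_cases hk : k ∈ S
    · simp only [flipNeg, flipPos, hk, Matrix.of_apply, Matrix.transpose_apply, if_true]
      ring
    · simp [flipNeg, flipPos, hk]
  · intro i j
    have h1 := congrFun (congrFun (pairing_flip S b D b D) i) j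
    have h2 := h.alternating.2 i j
    simp only [pairing, Matrix.add_apply, Matrix.mul_apply, Matrix.transpose_apply] at h1 h2 ⊢
    have h3 : ∀ P Q : Matrix (Fin n) (Fin n) k, ∑ l, P l i * Q l j = ∑ l, Q l j * P l i :=
      fun P Q => Finset.sum_congr rfl fun l _ => mul_comm _ _
    rw [h3 b D, h2, h3 (flipNeg S b D)] at h1
    rw [eq_neg_iff_add_eq_zero, add_comm, h1, add_neg_cancel]

/-- After exchanging suitable coordinates a Lagrangian subspace is the graph of a map. The set `S`
is maximal such that the vectors of the subspace whose second component vanishes have arbitrary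
coordinates in `S`. -/
theorem exists_flipPos_injective (h : IsLagrangian b D) :
    ∃ S : Finset (Fin n), ∀ u, flipPos S b D *ᵥ u = 0 → u = 0 := by
  classical
  obtain ⟨S, hS⟩ := (Finset.univ.filter fun S : Finset (Fin n) =>
    ∀ f : Fin n → k, ∃ u, D *ᵥ u = 0 ∧ ∀ i ∈ S, (b *ᵥ u) i = f i).exists_maximal
      ⟨∅, by simpa using ⟨0, by simp⟩⟩
  have hsur := (Finset.mem_filter.1 hS.1).2
  refine ⟨S, fun u hu => ?_⟩
  have hbS : ∀ i ∈ S, (b *ᵥ u) i = 0 := fun i hi => by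
    have := congrFun hu i
    simp only [mulVec, dotProduct, flipPos, Matrix.of_apply, hi, if_true, neg_mul,
      Finset.sum_neg_distrib, Pi.zero_apply, neg_eq_zero] at this
    exact this
  have hDS : ∀ i ∉ S, (D *ᵥ u) i = 0 := fun i hi => by
    have := congrFun hu i
    simp only [mulVec, dotProduct, flipPos, Matrix.of_apply, hi, if_false, Pi.zero_apply] at this
    exact this
  have hD : D *ᵥ u = 0 := by
    funext i
    by_cases hi : i ∈ S
    · obtain ⟨v, hv, hv'⟩ := hsur (Pi.single i 1)
      have h1 := h.dotProduct_eq_zero u v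
      rw [hv, dotProduct_zero, add_zero, dotProduct, Finset.sum_eq_single i] at h1
      · rwa [hv' i hi, Pi.single_eq_same, mul_one] at h1
      · intro l _ hl
        by_cases hlS : l ∈ S
        · rw [hv' l hlS, Pi.single_eq_of_ne hl, mul_zero]
        · rw [hDS l hlS, zero_mul]
      · simp
    · exact hDS i hi
  refine h.injective u ?_ hD
  by_contra hne
  obtain ⟨i, hi⟩ := Function.ne_iff.1 hne
  simp only [Pi.zero_apply] at hi
  have hiS : i ∉ S := fun hiS => hi (hbS i hiS)
  refine hiS (hS.2 (y := insert i S) ?_ (Finset.subset_insert i S) (Finset.mem_insert_self i S))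
  simp only [Finset.mem_filter, Finset.mem_univ, true_and]
  intro f
  obtain ⟨v, hv, hv'⟩ := hsur f
  refine ⟨v + ((f i - (b *ᵥ v) i) / (b *ᵥ u) i) • u, ?_, fun l hl => ?_⟩
  · rw [mulVec_add, mulVec_smul, hv, hD]
    simp
  · rw [mulVec_add, mulVec_smul, Pi.add_apply, Pi.smul_apply, smul_eq_mul]
    rcases Finset.mem_insert.1 hl with rfl | hl
    · field_simp
      ring
    · rw [hbS l hl, hv' l hl]
      ring

/-- Every Lagrangian subspace is spanned by exactly one reduced echelon basis, described by the set
`S` of exchanged pivots and an alternating matrix `Y`; here is the existence. The set `S` is the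
smallest one, for the weights `2 ^ (n - i)`, for which the exchanged subspace is a graph: if the
entry `Y i j` with `i ∈ S`, `i < j` were not zero, the `2 × 2` minor `(Y i j) ^ 2` would allow the
status of both `i` and `j` to be changed, and this makes the weight of `S` smaller. -/
theorem exists_echelon (h : IsLagrangian b D) :
    ∃ (S : Finset (Fin n)) (Y : Matrix (Fin n) (Fin n) k), IsAlternating Y ∧
      (∀ i j, i ∈ S → i < j → Y i j = 0) ∧
      pairing (flipNeg S Y 1) (flipPos S Y 1) b D = 0 := by
  classical
  obtain ⟨S₀, hS₀⟩ := h.exists_flipPos_injective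
  obtain ⟨S, hS, hmin⟩ := (Finset.univ.filter fun S : Finset (Fin n) =>
    ∀ u, flipPos S b D *ᵥ u = 0 → u = 0).exists_min_image
      (fun S => ∑ i ∈ S, 2 ^ (n - i.1)) ⟨S₀, by simpa using hS₀⟩
  replace hS := (Finset.mem_filter.1 hS).2
  set E := flipPos S b D with hE
  have hunit : IsUnit E := by
    rw [← Matrix.mulVec_injective_iff_isUnit]
    intro u v huv
    rw [← sub_eq_zero]
    exact hS _ (by rw [mulVec_sub, sub_eq_zero]; exact huv)
  have hdet := (Matrix.isUnit_iff_isUnit_det E).1 hunit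
  have hYE : flipNeg S b D * E⁻¹ * E = flipNeg S b D := by
    rw [Matrix.mul_assoc, Matrix.nonsing_inv_mul _ hdet, Matrix.mul_one]
  have hY : IsAlternating (flipNeg S b D * E⁻¹) := by
    have h1 := (h.flip S).conj E⁻¹
    rwa [← hE, ← Matrix.mul_assoc, ← Matrix.transpose_mul, Matrix.mul_nonsing_inv _ hdet,
      Matrix.transpose_one, Matrix.one_mul] at h1
  set Y := flipNeg S b D * E⁻¹ with hYdef
  refine ⟨S, Y, hY, fun i j hi hij => ?_, ?_⟩
  · by_contra hne
    have hji : j ≠ i := hij.ne'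
    -- the exchanged set: remove `i`, and change the status of `j`
    obtain ⟨T, hTi, hTj, hT, hTw⟩ : ∃ T : Finset (Fin n), i ∉ T ∧ (j ∈ T ↔ j ∉ S) ∧
        (∀ l, l ≠ i → l ≠ j → (l ∈ T ↔ l ∈ S)) ∧
        ∑ l ∈ T, 2 ^ (n - l.1) < ∑ l ∈ S, 2 ^ (n - l.1) := by
      have hw : 2 ^ (n - j.1) < 2 ^ (n - i.1) := Nat.pow_lt_pow_right (by norm_num) (by omega)
      have hsum := Finset.sum_erase_add S (fun l : Fin n => 2 ^ (n - l.1)) hi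
      by_cases hj : j ∈ S
      · refine ⟨(S.erase i).erase j, by simp, by simp [hj],
          fun l h1 h2 => by simp [h1, h2], ?_⟩
        have := Finset.sum_erase_add (S.erase i) (fun l : Fin n => 2 ^ (n - l.1))
          (Finset.mem_erase.2 ⟨hji, hj⟩)
        have := Nat.two_pow_pos (n - j.1)
        omega
      · refine ⟨insert j (S.erase i), by simp [hji.symm], by simp [hj],
          fun l h1 h2 => by simp [h1, h2], ?_⟩
        rw [Finset.sum_insert (by simp [hj])]
        omega
    refine absurd (hmin T ?_) (not_le.2 hTw)
    simp only [Finset.mem_filter, Finset.mem_univ, true_and]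
    intro u hu
    apply hS
    have hrow : ∀ l, (flipNeg S b D *ᵥ u) l = (Y *ᵥ (E *ᵥ u)) l := fun l => by
      rw [mulVec_mulVec, hYE]
    have hsame : ∀ l, l ≠ i → l ≠ j → (E *ᵥ u) l = 0 := fun l h1 h2 => by
      rw [← Pi.zero_apply (M := fun _ => k) l, ← hu]
      simp only [hE, mulVec, dotProduct, flipPos, Matrix.of_apply, hT l h1 h2]
    have hdiff : ∀ l, (l ∈ T ↔ l ∉ S) → (Y *ᵥ (E *ᵥ u)) l = 0 := fun l hl => by
      have h1 := congrFun hu l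
      rw [← hrow, ← neg_eq_zero, ← Pi.zero_apply (M := fun _ => k) l, ← h1]
      simp only [mulVec, dotProduct, flipPos, flipNeg, Matrix.of_apply, hl,
        ← Finset.sum_neg_distrib]
      refine Finset.sum_congr rfl fun x _ => ?_
      by_cases hlS : l ∈ S <;> simp [hlS]
    have hi0 := hdiff i (by simp [hTi, hi])
    have hj0 := hdiff j hTj
    generalize E *ᵥ u = v at hsame hi0 hj0 ⊢
    rw [mulVec, dotProduct, Finset.sum_eq_single j (fun l _ hl => ?_) (by simp)] at hi0
    swap
    · by_cases hli : l = i
      · rw [hli, hY.1, zero_mul]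
      · rw [hsame l hli hl, mul_zero]
    rw [mulVec, dotProduct, Finset.sum_eq_single i (fun l _ hl => ?_) (by simp)] at hj0
    swap
    · by_cases hlj : l = j
      · rw [hlj, hY.1, zero_mul]
      · rw [hsame l hl hlj, mul_zero]
    rw [hY.2 i j] at hj0
    funext l
    by_cases hli : l = i
    · subst hli
      exact (mul_eq_zero.1 hj0).resolve_left (_root_.neg_ne_zero.2 hne)
    by_cases hlj : l = j
    · subst hlj
      exact (mul_eq_zero.1 hi0).resolve_left hne
    exact hsame l hli hlj
  · rw [← pairing_flip S, flipNeg_flip, flipPos_flip, ← hE, pairing, ← hYE,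
      Matrix.transpose_one, Matrix.one_mul, ← Matrix.add_mul]
    have : Y + Yᵀ = 0 := by
      ext i j
      simp [hY.2 i j]
    rw [this, Matrix.zero_mul]

end IsLagrangian

section Uniqueness

variable {S S' : Finset (Fin n)} {Y Y' : Matrix (Fin n) (Fin n) k}

/-- Two reduced echelon bases of the same Lagrangian subspace have the same pivots: if
`j ∈ S \ S'`, the two `j`-th basis vectors have only one pair of nonzero dual coordinates, those
of the pivots, so that they are not orthogonal. -/
theorem subset_of_pairing_eq_zero (hY : IsAlternating Y) (hYS : ∀ i j, i ∈ S → i < j → Y i j = 0)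
    (hYS' : ∀ i j, i ∈ S' → i < j → Y' i j = 0)
    (h : pairing (flipNeg S Y 1) (flipPos S Y 1) (flipNeg S' Y' 1) (flipPos S' Y' 1) = 0) :
    S ⊆ S' := by
  intro j hj
  by_contra hj'
  have h1 := congrFun (congrFun h j) j
  simp only [pairing, Matrix.add_apply, Matrix.mul_apply, ← Finset.sum_add_distrib] at h1
  have hcol : ∀ i, j ≤ i → Y i j = 0 := fun i hi => by
    rcases hi.eq_or_lt with rfl | hi
    · exact hY.1 j
    · rw [hY.2 j i, hYS j i hj hi, neg_zero]
  have hcolS : ∀ i ∈ S, Y i j = 0 := fun i hi => by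
    rcases lt_or_ge i j with hij | hij
    · exact hYS i j hi hij
    · exact hcol i hij
  rw [Finset.sum_eq_single j] at h1
  · simp [flipNeg, flipPos, hj, hj', hcolS] at h1
  · intro i _ hij
    have h2 : flipPos S Y 1 i j = 0 := by
      by_cases hi : i ∈ S <;> simp [flipPos, hi, hij, hcolS]
    have h3 : flipNeg S Y 1 i j * flipPos S' Y' 1 i j = 0 := by
      rcases lt_or_gt_of_ne hij with hlt | hgt
      · by_cases hi : i ∈ S' <;> simp [flipPos, hi, hij, hYS' i j, hlt]
      · by_cases hi : i ∈ S <;> simp [flipNeg, hi, hij, hcol i hgt.le]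
    simp [Matrix.transpose_apply, h2, h3]
  · simp

theorem echelon_unique (hY : IsAlternating Y) (hYS : ∀ i j, i ∈ S → i < j → Y i j = 0)
    (hY' : IsAlternating Y') (hYS' : ∀ i j, i ∈ S' → i < j → Y' i j = 0)
    (h : pairing (flipNeg S Y 1) (flipPos S Y 1) (flipNeg S' Y' 1) (flipPos S' Y' 1) = 0) :
    S = S' ∧ Y = Y' := by
  have h' : pairing (flipNeg S' Y' 1) (flipPos S' Y' 1) (flipNeg S Y 1) (flipPos S Y 1) = 0 := by
    have := congrArg Matrix.transpose h
    rw [pairing, Matrix.transpose_add, Matrix.transpose_mul, Matrix.transpose_mul,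
      Matrix.transpose_transpose, Matrix.transpose_transpose, Matrix.transpose_zero,
      add_comm] at this
    exact this
  obtain rfl : S = S' := (subset_of_pairing_eq_zero hY hYS hYS' h).antisymm
    (subset_of_pairing_eq_zero hY' hYS' hYS h')
  refine ⟨rfl, ?_⟩
  rw [pairing_flip, pairing, Matrix.transpose_one, Matrix.one_mul, Matrix.mul_one] at h
  ext i j
  have := congrFun (congrFun h i) j
  rw [Matrix.add_apply, Matrix.transpose_apply, hY.2 i j, Matrix.zero_apply] at this
  linear_combination -this

end Uniqueness

end Lagrangian

/-! ### Matrix entries of inverses, Weyl elements and root elements -/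

section Entries

variable {n : ℕ} {F : Type*} [Field F]

theorem gram_neg_neg (i j : Fin n) : gram n F (neg i) (neg j) = 0 := rfl

theorem gram_neg_zero (i : Fin n) : gram n F (neg i) zero = 0 := rfl

theorem gram_neg_pos (i j : Fin n) : gram n F (neg i) (pos j) = if i = j then 1 else 0 := by
  simp [gram, neg, pos, eq_comm]

theorem gram_zero_neg (i : Fin n) : gram n F zero (neg i) = 0 := rfl

theorem gram_zero_pos (i : Fin n) : gram n F zero (pos i) = 0 := rfl

theorem gram_pos_neg (i j : Fin n) : gram n F (pos i) (neg j) = if i = j then 1 else 0 := by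
  simp [gram, neg, pos, eq_comm]

theorem gram_pos_zero (i : Fin n) : gram n F (pos i) zero = 0 := rfl

theorem gram_pos_pos (i j : Fin n) : gram n F (pos i) (pos j) = 0 := rfl

theorem gram_transpose : (gram n F).transpose = gram n F := by
  ext a b
  rw [Matrix.transpose_apply]
  rcases idx_cases a with ⟨i, rfl⟩ | rfl | ⟨i, rfl⟩ <;>
    rcases idx_cases b with ⟨l, rfl⟩ | rfl | ⟨l, rfl⟩ <;>
    simp [gram_neg_neg, gram_neg_zero, gram_neg_pos, gram_zero_neg, gram_zero_pos, gram_pos_neg,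
      gram_pos_zero, gram_pos_pos, eq_comm]

theorem mul_gram_neg (M : Matrix (Idx n) (Idx n) F) (a : Idx n) (i : Fin n) :
    (M * gram n F) a (neg i) = M a (pos i) := by
  rw [← Matrix.transpose_apply (M * gram n F), Matrix.transpose_mul, gram_transpose,
    gram_mul_neg, Matrix.transpose_apply]

theorem mul_gram_pos (M : Matrix (Idx n) (Idx n) F) (a : Idx n) (i : Fin n) :
    (M * gram n F) a (pos i) = M a (neg i) := by
  rw [← Matrix.transpose_apply (M * gram n F), Matrix.transpose_mul, gram_transpose,
    gram_mul_pos, Matrix.transpose_apply]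

section Inverse

variable {g : GL (Idx n) F}

theorem inv_neg_neg (hg : g ∈ SO n F) (i j : Fin n) :
    (g⁻¹ : GL (Idx n) F) (neg i) (neg j) = g (pos j) (pos i) := by
  have h := congrFun (congrFun (gram_mul_eq hg) (neg j)) (pos i)
  rw [gram_mul_neg, mul_gram_pos, Matrix.transpose_apply] at h
  exact h.symm

theorem inv_neg_pos (hg : g ∈ SO n F) (i j : Fin n) :
    (g⁻¹ : GL (Idx n) F) (neg i) (pos j) = g (neg j) (pos i) := by
  have h := congrFun (congrFun (gram_mul_eq hg) (pos j)) (pos i)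
  rw [gram_mul_pos, mul_gram_pos, Matrix.transpose_apply] at h
  exact h.symm

theorem inv_pos_neg (hg : g ∈ SO n F) (i j : Fin n) :
    (g⁻¹ : GL (Idx n) F) (pos i) (neg j) = g (pos j) (neg i) := by
  have h := congrFun (congrFun (gram_mul_eq hg) (neg j)) (neg i)
  rw [gram_mul_neg, mul_gram_neg, Matrix.transpose_apply] at h
  exact h.symm

theorem inv_pos_pos (hg : g ∈ SO n F) (i j : Fin n) :
    (g⁻¹ : GL (Idx n) F) (pos i) (pos j) = g (neg j) (neg i) := by
  have h := congrFun (congrFun (gram_mul_eq hg) (pos j)) (neg i)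
  rw [gram_mul_pos, mul_gram_neg, Matrix.transpose_apply] at h
  exact h.symm

theorem inv_neg_zero (hg : g ∈ SO n F) (i : Fin n) :
    (g⁻¹ : GL (Idx n) F) (neg i) zero = 2 * g zero (pos i) := by
  simpa using apply_neg_zero (Subgroup.inv_mem _ hg) i

theorem inv_pos_zero (hg : g ∈ SO n F) (i : Fin n) :
    (g⁻¹ : GL (Idx n) F) (pos i) zero = 2 * g zero (neg i) := by
  simpa using apply_pos_zero (Subgroup.inv_mem _ hg) i

/-- The entry of `g⁻¹ * h` at `(e_{-n-1+i}, b)` is the scalar product of two columns, of `g` and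
of `h`. -/
theorem inv_mul_neg (hg : g ∈ SO n F) (h : GL (Idx n) F) (i : Fin n) (b : Idx n) :
    (g⁻¹ * h : GL (Idx n) F) (neg i) b = 2 * g zero (pos i) * h zero b +
      ((∑ k, g (pos k) (pos i) * h (neg k) b) + ∑ k, g (neg k) (pos i) * h (pos k) b) := by
  rw [Units.val_mul, Matrix.mul_apply, sum_idx, inv_neg_zero hg]
  simp only [inv_neg_neg hg, inv_neg_pos hg]

theorem inv_mul_pos (hg : g ∈ SO n F) (h : GL (Idx n) F) (i : Fin n) (b : Idx n) :
    (g⁻¹ * h : GL (Idx n) F) (pos i) b = 2 * g zero (neg i) * h zero b +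
      ((∑ k, g (pos k) (neg i) * h (neg k) b) + ∑ k, g (neg k) (neg i) * h (pos k) b) := by
  rw [Units.val_mul, Matrix.mul_apply, sum_idx, inv_pos_zero hg]
  simp only [inv_pos_neg hg, inv_pos_pos hg]

end Inverse

section Weyl

theorem det_monomial (σ : Equiv.Perm (Idx n)) (c : Idx n → F) :
    (monomial σ c).det = (∏ b, c b) * ((Equiv.Perm.sign σ : ℤ) : F) := by
  have h : monomial σ c =
      Matrix.of fun a b => c b * (1 : Matrix (Idx n) (Idx n) F).submatrix id σ a b := by
    ext a b
    simp [monomial, Matrix.one_apply]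
  rw [h, Matrix.det_mul_row, Matrix.det_permute', Matrix.det_one, mul_one]

theorem monomial_mul_apply (σ : Equiv.Perm (Idx n)) (c : Idx n → F)
    (M : Matrix (Idx n) (Idx n) F) (a b : Idx n) :
    (monomial σ c * M) (σ a) b = c a * M a b := by
  rw [Matrix.mul_apply, Finset.sum_eq_single a]
  · rw [monomial_apply_eq rfl]
  · intro x _ hx
    rw [monomial_apply_ne (fun h => hx (σ.injective h).symm), zero_mul]
  · simp

theorem transpose_mul_gram_mul_monomial (σ : Equiv.Perm (Idx n)) (c : Idx n → F) (a b : Idx n) :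
    ((monomial σ c).transpose * gram n F * monomial σ c) a b =
      c a * c b * gram n F (σ a) (σ b) := by
  rw [Matrix.mul_apply, Finset.sum_eq_single (σ b)]
  · rw [monomial_apply_eq rfl, Matrix.mul_apply, Finset.sum_eq_single (σ a)]
    · rw [Matrix.transpose_apply, monomial_apply_eq rfl]
      ring
    · intro x _ hx
      rw [Matrix.transpose_apply, monomial_apply_ne hx, zero_mul]
    · simp
  · intro x _ hx
    rw [monomial_apply_ne hx, mul_zero]
  · simp

theorem det_weylMat (j : Fin n) (t : Fˣ) : (weylMat j t).det = 1 := by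
  have h : ∏ b, weylCoeff j t b = -1 := by
    rw [← Finset.prod_subset (Finset.subset_univ {pos j, neg j, (zero : Idx n)})]
    · rw [Finset.prod_insert (by simp [pos_ne_neg, pos_ne_zero]),
        Finset.prod_insert (by simp [neg_ne_zero]), Finset.prod_singleton]
      simp [weylCoeff, neg_ne_pos, zero_ne_neg, zero_ne_pos]
    · intro b _ hb
      simp only [Finset.mem_insert, Finset.mem_singleton, not_or] at hb
      simp [weylCoeff, hb]
  rw [weylMat, det_monomial, h, Equiv.Perm.sign_swap (neg_ne_pos j j)]
  simp

theorem swap_neg (j i : Fin n) :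
    Equiv.swap (neg j) (pos j) (neg i : Idx n) = if i = j then pos i else neg i := by
  by_cases h : i = j
  · simp [h]
  · rw [Equiv.swap_apply_of_ne_of_ne (by simpa [neg_inj] using h) (neg_ne_pos _ _), if_neg h]

theorem swap_pos (j i : Fin n) :
    Equiv.swap (neg j) (pos j) (pos i : Idx n) = if i = j then neg i else pos i := by
  by_cases h : i = j
  · simp [h]
  · rw [Equiv.swap_apply_of_ne_of_ne (pos_ne_neg _ _) (by simpa [pos_inj] using h), if_neg h]

theorem swap_zero (j : Fin n) : Equiv.swap (neg j) (pos j) (zero : Idx n) = zero :=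
  Equiv.swap_apply_of_ne_of_ne (zero_ne_neg _) (zero_ne_pos _)

theorem weylCoeff_neg (j i : Fin n) (t : Fˣ) :
    weylCoeff j t (neg i) = if i = j then -(t : F) else 1 := by
  simp [weylCoeff, neg_ne_pos, neg_inj, neg_ne_zero]

theorem weylCoeff_pos (j i : Fin n) (t : Fˣ) :
    weylCoeff j t (pos i) = if i = j then -(t : F)⁻¹ else 1 := by
  simp [weylCoeff, pos_ne_neg, pos_inj, pos_ne_zero]

theorem weylCoeff_zero (j : Fin n) (t : Fˣ) : weylCoeff j t zero = -1 := by
  simp [weylCoeff, zero_ne_pos, zero_ne_neg]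

theorem weylElt_mem_SO (j : Fin n) (t : Fˣ) : weylElt j t ∈ SO n F := by
  refine ⟨det_weylMat j t, ?_⟩
  change (weylMat j t).transpose * gram n F * weylMat j t = gram n F
  ext a b
  rw [weylMat, transpose_mul_gram_mul_monomial]
  rcases idx_cases a with ⟨i, rfl⟩ | rfl | ⟨i, rfl⟩ <;>
    rcases idx_cases b with ⟨l, rfl⟩ | rfl | ⟨l, rfl⟩ <;>
    simp only [swap_neg, swap_pos, swap_zero, weylCoeff_neg, weylCoeff_pos, weylCoeff_zero] <;>
    (try split_ifs) <;>
    simp_all [gram_neg_neg, gram_neg_zero, gram_neg_pos, gram_zero_neg, gram_zero_pos,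
      gram_pos_neg, gram_pos_zero, gram_pos_pos, eq_comm]

theorem weylMat_mul_neg (j i : Fin n) (t : Fˣ) (M : Matrix (Idx n) (Idx n) F) (b : Idx n) :
    (weylMat j t * M) (neg i) b =
      if i = j then -(t : F)⁻¹ * M (pos i) b else M (neg i) b := by
  by_cases h : i = j
  · have h1 := monomial_mul_apply (Equiv.swap (neg j) (pos j)) (weylCoeff j t) M (pos i) b
    rw [swap_pos, if_pos h, weylCoeff_pos, if_pos h] at h1
    rw [if_pos h, ← h1, weylMat]
  · have h1 := monomial_mul_apply (Equiv.swap (neg j) (pos j)) (weylCoeff j t) M (neg i) b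
    rw [swap_neg, if_neg h, weylCoeff_neg, if_neg h, one_mul] at h1
    rw [if_neg h, ← h1, weylMat]

theorem weylMat_mul_pos (j i : Fin n) (t : Fˣ) (M : Matrix (Idx n) (Idx n) F) (b : Idx n) :
    (weylMat j t * M) (pos i) b = if i = j then -(t : F) * M (neg i) b else M (pos i) b := by
  by_cases h : i = j
  · have h1 := monomial_mul_apply (Equiv.swap (neg j) (pos j)) (weylCoeff j t) M (neg i) b
    rw [swap_neg, if_pos h, weylCoeff_neg, if_pos h] at h1
    rw [if_pos h, ← h1, weylMat]
  · have h1 := monomial_mul_apply (Equiv.swap (neg j) (pos j)) (weylCoeff j t) M (pos i) b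
    rw [swap_pos, if_neg h, weylCoeff_pos, if_neg h, one_mul] at h1
    rw [if_neg h, ← h1, weylMat]

theorem weylMat_mul_zero (j : Fin n) (t : Fˣ) (M : Matrix (Idx n) (Idx n) F) (b : Idx n) :
    (weylMat j t * M) zero b = -M zero b := by
  have h1 := monomial_mul_apply (Equiv.swap (neg j) (pos j)) (weylCoeff j t) M zero b
  rw [swap_zero, weylCoeff_zero, neg_one_mul] at h1
  rw [← h1, weylMat]

theorem weylS_insert (ϖ : Fˣ) (m : ℕ) {S : Finset (Fin n)} {j : Fin n} (hj : j ∉ S) :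
    weylS ϖ m (insert j S) = weylElt j (ϖ ^ m) * weylS ϖ m S :=
  Finset.noncommProd_insert_of_notMem _ _ _ _ hj

/-- The action of `w_{S,m}` on the rows of a matrix. -/
theorem weylS_mul_apply (ϖ : Fˣ) (m : ℕ) (S : Finset (Fin n)) (h : GL (Idx n) F) (b : Idx n) :
    (∀ i, (weylS ϖ m S * h : GL (Idx n) F) (neg i) b =
      if i ∈ S then -((ϖ : F) ^ m)⁻¹ * h (pos i) b else h (neg i) b) ∧
    (∀ i, (weylS ϖ m S * h : GL (Idx n) F) (pos i) b =
      if i ∈ S then -(ϖ : F) ^ m * h (neg i) b else h (pos i) b) ∧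
    (weylS ϖ m S * h : GL (Idx n) F) zero b = (-1) ^ S.card * h zero b := by
  induction S using Finset.induction_on with
  | empty =>
    rw [show weylS ϖ m (∅ : Finset (Fin n)) = (1 : GL (Idx n) F) from
      Finset.noncommProd_empty _ _]
    simp
  | insert j S hj ih =>
    obtain ⟨ih1, ih2, ih3⟩ := ih
    have hmul : ((weylS ϖ m (insert j S) * h : GL (Idx n) F) : Matrix (Idx n) (Idx n) F) =
        weylMat j (ϖ ^ m) * (weylS ϖ m S * h : GL (Idx n) F) := by
      rw [weylS_insert ϖ m hj, mul_assoc, Units.val_mul]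
      rfl
    rw [hmul]
    refine ⟨fun i => ?_, fun i => ?_, ?_⟩
    · rw [weylMat_mul_neg, ih1, ih2]
      by_cases hij : i = j
      · subst hij
        simp [hj]
      · simp [hij]
    · rw [weylMat_mul_pos, ih1, ih2]
      by_cases hij : i = j
      · subst hij
        simp [hj]
      · simp [hij]
    · rw [weylMat_mul_zero, ih3, Finset.card_insert_of_notMem hj, pow_succ]
      ring

end Weyl

section Root

theorem det_rootElt (i j : Fin n) (y : F) :
    (rootElt i j y : Matrix (Idx n) (Idx n) F).det = 1 := by
  have h : (rootElt i j y : Matrix (Idx n) (Idx n) F) =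
      Matrix.transvection (neg i) (pos j) y * Matrix.transvection (neg j) (pos i) (-y) := by
    change 1 + rootMat i j y = _
    have h0 : Matrix.single (neg j) (pos i) (-y) =
        -(Matrix.single (neg j) (pos i) y : Matrix (Idx n) (Idx n) F) := by
      ext a b
      simp only [Matrix.single_apply, Matrix.neg_apply]
      split_ifs <;> simp
    rw [Matrix.transvection, Matrix.transvection, mul_add, add_mul, add_mul,
      Matrix.single_mul_single_of_ne _ _ _ _ (pos_ne_neg j j), h0, rootMat]
    simp only [mul_one, one_mul, add_zero]
    abel
  rw [h, Matrix.det_mul, Matrix.det_transvection_of_ne _ _ (neg_ne_pos i j),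
    Matrix.det_transvection_of_ne _ _ (neg_ne_pos j i), mul_one]

theorem rootMat_row_pos (i j l : Fin n) (y : F) (b : Idx n) : rootMat i j y (pos l) b = 0 := by
  simp [rootMat, neg_ne_pos]

theorem rootMat_row_zero (i j : Fin n) (y : F) (b : Idx n) : rootMat i j y zero b = 0 := by
  simp [rootMat, neg_ne_zero]

theorem rootMat_neg_pos (i j k l : Fin n) (y : F) :
    rootMat i j y (neg k) (pos l) =
      (if (i, j) = (k, l) then y else 0) - if (i, j) = (l, k) then y else 0 := by
  simp only [rootMat, Matrix.sub_apply, Matrix.single_apply, neg_inj, pos_inj, Prod.mk.injEq,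
    and_comm (a := j = k)]

theorem rootMat_neg_neg (i j k l : Fin n) (y : F) : rootMat i j y (neg k) (neg l) = 0 := by
  simp [rootMat, pos_ne_neg]

theorem rootMat_neg_zero (i j k : Fin n) (y : F) : rootMat i j y (neg k) zero = 0 := by
  simp [rootMat, pos_ne_zero]

theorem rootElt_mem_SO (i j : Fin n) (y : F) : rootElt i j y ∈ SO n F := by
  refine ⟨det_rootElt i j y, ?_⟩
  change (1 + rootMat i j y).transpose * gram n F * (1 + rootMat i j y) = gram n F
  have h1 : (gram n F * rootMat i j y).transpose = -(gram n F * rootMat i j y) := by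
    ext a b
    rw [Matrix.transpose_apply, Matrix.neg_apply]
    rcases idx_cases a with ⟨k, rfl⟩ | rfl | ⟨k, rfl⟩ <;>
      rcases idx_cases b with ⟨l, rfl⟩ | rfl | ⟨l, rfl⟩ <;>
      simp only [gram_mul_neg, gram_mul_zero, gram_mul_pos, rootMat_row_pos, rootMat_row_zero,
        rootMat_neg_neg, rootMat_neg_zero, rootMat_neg_pos, mul_zero, neg_zero]
    ring
  have h2 : (rootMat i j y).transpose * gram n F = -(gram n F * rootMat i j y) := by
    rw [← h1, Matrix.transpose_mul, gram_transpose]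
  rw [Matrix.transpose_add, Matrix.transpose_one, Matrix.add_mul, Matrix.one_mul, h2,
    Matrix.mul_add, Matrix.mul_one, Matrix.add_mul, Matrix.neg_mul, Matrix.mul_assoc,
    rootMat_mul_rootMat]
  simp

/-- The alternating matrix with entries `c_β` at the positions `β ∈ I_S`. -/
def altMat {R : Type*} [CommRing R] (S : Finset (Fin n)) (c : rootSet S → R) :
    Matrix (Fin n) (Fin n) R :=
  Matrix.of fun i j =>
    ∑ β : rootSet S, ((if β.1 = (i, j) then c β else 0) - if β.1 = (j, i) then c β else 0)

section AltMat

variable {R : Type*} [CommRing R] {S : Finset (Fin n)}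

theorem isAlternating_altMat (c : rootSet S → R) : IsAlternating (altMat S c) := by
  constructor
  · intro i
    simp [altMat]
  · intro i j
    simp only [altMat, Matrix.of_apply, ← Finset.sum_neg_distrib, neg_sub]

theorem altMat_eq_zero (c : rootSet S → R) (i j : Fin n) (hi : i ∈ S) (hij : i < j) :
    altMat S c i j = 0 := by
  refine Finset.sum_eq_zero fun β _ => ?_
  have hβ := (Finset.mem_filter.1 β.2).2
  rw [if_neg, if_neg, sub_zero]
  · intro h
    rw [h] at hβ
    exact lt_asymm hβ.1 hij
  · intro h
    rw [h] at hβ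
    exact hβ.2 hi

theorem altMat_apply (c : rootSet S → R) (β : rootSet S) :
    altMat S c β.1.1 β.1.2 = c β := by
  have hβ := (Finset.mem_filter.1 β.2).2
  rw [altMat, Matrix.of_apply, Finset.sum_eq_single β]
  · rw [if_pos rfl, if_neg, sub_zero]
    intro h
    rw [Prod.ext_iff] at h
    exact hβ.1.ne h.1
  · intro γ _ hγ
    have hγ' := (Finset.mem_filter.1 γ.2).2
    rw [if_neg (fun h => hγ (Subtype.ext h)), if_neg, sub_zero]
    intro h
    rw [h] at hγ'
    exact lt_asymm hγ'.1 hβ.1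
  · simp

theorem altMat_injective : Function.Injective (altMat S : (rootSet S → R) → _) :=
  fun c d h => funext fun β => by rw [← altMat_apply c, h, altMat_apply]

theorem altMat_map {R' : Type*} [CommRing R'] (f : R →+* R') (c : rootSet S → R) :
    (altMat S c).map f = altMat S (fun β => f (c β)) := by
  ext i j
  simp only [altMat, Matrix.map_apply, Matrix.of_apply, map_sum, map_sub]
  refine Finset.sum_congr rfl fun β _ => ?_
  split_ifs <;> simp

theorem eq_altMat {Y : Matrix (Fin n) (Fin n) R} (hY : IsAlternating Y)
    (hYS : ∀ i j, i ∈ S → i < j → Y i j = 0) :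
    Y = altMat S (fun β => Y β.1.1 β.1.2) := by
  have key : ∀ i j, i < j → Y i j = altMat S (fun β => Y β.1.1 β.1.2) i j := fun i j hij => by
    by_cases hi : i ∈ S
    · rw [hYS i j hi hij, altMat_eq_zero _ i j hi hij]
    · exact (altMat_apply (fun β : rootSet S => Y β.1.1 β.1.2)
        ⟨(i, j), Finset.mem_filter.2 ⟨Finset.mem_univ _, hij, hi⟩⟩).symm
  have halt := isAlternating_altMat (fun β : rootSet S => Y β.1.1 β.1.2)
  ext i j
  rcases lt_trichotomy i j with h | rfl | h
  · exact key i j h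
  · rw [hY.1, halt.1]
  · rw [hY.2 j i, halt.2 j i, key j i h]

end AltMat

theorem rootProd_eq (S : Finset (Fin n)) (c : rootSet S → F) :
    (rootProd S c : Matrix (Idx n) (Idx n) F) =
      1 + ∑ β : rootSet S, rootMat β.1.1 β.1.2 (c β) := by
  classical
  have key : ∀ (T : Finset (rootSet S)) (comm : (T : Set (rootSet S)).Pairwise
      (Function.onFun Commute fun β : rootSet S => rootElt β.1.1 β.1.2 (c β))),
      ((T.noncommProd (fun β : rootSet S => rootElt β.1.1 β.1.2 (c β)) comm : GL (Idx n) F) :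
          Matrix (Idx n) (Idx n) F) = 1 + ∑ β ∈ T, rootMat β.1.1 β.1.2 (c β) := by
    intro T
    induction T using Finset.induction_on with
    | empty => simp
    | insert β T hβ ih =>
      intro comm
      rw [Finset.noncommProd_insert_of_notMem _ _ _ _ hβ, Units.val_mul, ih,
        Finset.sum_insert hβ]
      change (1 + rootMat β.1.1 β.1.2 (c β)) * _ = _
      have h0 : rootMat β.1.1 β.1.2 (c β) * ∑ γ ∈ T, rootMat γ.1.1 γ.1.2 (c γ) = 0 := by
        rw [Finset.mul_sum]
        exact Finset.sum_eq_zero fun γ _ => rootMat_mul_rootMat _ _ _ _ _ _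
      rw [mul_add, add_mul, add_mul, h0, mul_one, mul_one, one_mul, add_zero]
      abel
  exact key Finset.univ _

variable (S : Finset (Fin n)) (c : rootSet S → F)

theorem rootProd_neg_pos (i j : Fin n) : rootProd S c (neg i) (pos j) = altMat S c i j := by
  rw [rootProd_eq, Matrix.add_apply, Matrix.one_apply_ne (neg_ne_pos _ _), zero_add,
    Matrix.sum_apply]
  simp only [rootMat_neg_pos, altMat, Matrix.of_apply]

theorem rootProd_pos (i : Fin n) (b : Idx n) :
    rootProd S c (pos i) b = (1 : Matrix (Idx n) (Idx n) F) (pos i) b := by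
  rw [rootProd_eq, Matrix.add_apply, Matrix.sum_apply]
  simp [rootMat_row_pos]

theorem rootProd_zero (b : Idx n) :
    rootProd S c zero b = (1 : Matrix (Idx n) (Idx n) F) zero b := by
  rw [rootProd_eq, Matrix.add_apply, Matrix.sum_apply]
  simp [rootMat_row_zero]

end Root

end Entries

/-! ### Integral coordinates on the stabilizers of the lattices -/

section Scale

variable {n : ℕ} {F : Type*} [Field F]

/-- The coefficients of an adapted basis: `L_m` is spanned over `𝔬` by the vectors
`scale (ϖ ^ m) a • e_a`. -/
def scale (t : F) (a : Idx n) : F :=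
  match a with
  | Sum.inl _ => 1
  | Sum.inr _ => t

theorem scale_neg (t : F) (i : Fin n) : scale t (neg i) = 1 := rfl

theorem scale_zero (t : F) : scale t (zero : Idx n) = t := rfl

theorem scale_pos (t : F) (i : Fin n) : scale t (pos i) = t := rfl

theorem scale_ne_zero {t : F} (ht : t ≠ 0) (a : Idx n) : scale t a ≠ 0 := by
  rcases idx_cases a with ⟨i, rfl⟩ | rfl | ⟨i, rfl⟩
  exacts [one_ne_zero, ht, ht]

end Scale

section Integral

open Matrix

variable {n : ℕ} {F : Type*} [Field F] [ValuativeRel F] {ϖ : Fˣ}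

theorem IsUniformizer.mem_integer (hϖ : IsUniformizer ϖ) : (ϖ : F) ∈ 𝒪[F] := by
  obtain ⟨π, _, h⟩ := hϖ
  rw [← h]
  exact π.2

theorem IsUniformizer.pow_mem (hϖ : IsUniformizer ϖ) (m : ℕ) : (ϖ : F) ^ m ∈ 𝒪[F] :=
  Subring.pow_mem _ hϖ.mem_integer m

theorem IsUniformizer.mem_pPow_iff (hϖ : IsUniformizer ϖ) (m : ℕ) (x : F) :
    x ∈ pPow F m ↔ ((ϖ : F) ^ m)⁻¹ * x ∈ 𝒪[F] := by
  obtain ⟨π, hπ, h⟩ := hϖ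
  have h0 : (ϖ : F) ^ m ≠ 0 := pow_ne_zero _ ϖ.ne_zero
  rw [pPow, hπ, Ideal.span_singleton_pow]
  constructor
  · rintro ⟨a, ha, rfl⟩
    obtain ⟨b, rfl⟩ := Ideal.mem_span_singleton.1 ha
    convert b.2 using 1
    simp only [Algebra.linearMap_apply, map_mul, map_pow]
    change ((ϖ : F) ^ m)⁻¹ * ((π : F) ^ m * (b : F)) = b
    rw [h, inv_mul_cancel_left₀ h0]
  · intro hx
    refine ⟨π ^ m * ⟨_, hx⟩, Ideal.mem_span_singleton.2 (Dvd.intro _ rfl), ?_⟩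
    simp only [Algebra.linearMap_apply, map_mul, map_pow]
    change (π : F) ^ m * (((ϖ : F) ^ m)⁻¹ * x) = x
    rw [h, mul_inv_cancel_left₀ h0]

theorem IsUniformizer.residue_eq_zero_iff (hϖ : IsUniformizer ϖ) (x : 𝒪[F]) :
    IsLocalRing.residue 𝒪[F] x = 0 ↔ (ϖ : F)⁻¹ * x ∈ 𝒪[F] := by
  rw [IsLocalRing.residue_eq_zero_iff]
  have h := hϖ.mem_pPow_iff 1 (x : F)
  rw [pow_one] at h
  rw [← h, pPow, pow_one]
  constructor
  · exact fun hx => ⟨x, hx, rfl⟩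
  · rintro ⟨y, hy, hyx⟩
    obtain rfl : y = x := Subtype.ext hyx
    exact hy

theorem mem_lattice_iff (hϖ : IsUniformizer ϖ) (m : ℕ) (v : Idx n → F) :
    v ∈ lattice n F m ↔ ∀ a, (scale ((ϖ : F) ^ m) a)⁻¹ * v a ∈ 𝒪[F] := by
  change ((∀ i, v (neg i) ∈ 𝒪[F]) ∧ v zero ∈ pPow F m ∧ ∀ i, v (pos i) ∈ pPow F m) ↔ _
  simp only [hϖ.mem_pPow_iff]
  constructor
  · rintro ⟨h1, h2, h3⟩ a
    rcases idx_cases a with ⟨i, rfl⟩ | rfl | ⟨i, rfl⟩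
    · simpa [scale_neg] using h1 i
    · exact h2
    · exact h3 i
  · intro h
    exact ⟨fun i => by simpa [scale_neg] using h (neg i), h zero, fun i => h (pos i)⟩

/-- The endomorphism with matrix `M` maps the lattice `⨁ 𝔬 (scale t a • e_a)` into itself. -/
def IsAdapted (t : F) (M : Matrix (Idx n) (Idx n) F) : Prop :=
  ∀ a b, (scale t a)⁻¹ * M a b * scale t b ∈ 𝒪[F]

theorem isAdapted_iff (hϖ : IsUniformizer ϖ) (m : ℕ) (M : Matrix (Idx n) (Idx n) F) :
    IsAdapted ((ϖ : F) ^ m) M ↔ ∀ v ∈ lattice n F m, M *ᵥ v ∈ lattice n F m := by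
  simp only [mem_lattice_iff hϖ]
  have h0 : ∀ a : Idx n, scale ((ϖ : F) ^ m) a ≠ 0 :=
    scale_ne_zero (pow_ne_zero _ ϖ.ne_zero)
  constructor
  · intro h v hv a
    rw [mulVec, dotProduct, Finset.mul_sum]
    refine Subring.sum_mem _ fun b _ => ?_
    have := Subring.mul_mem _ (h a b) (hv b)
    rwa [mul_assoc _ _ (_ * v b), mul_inv_cancel_left₀ (h0 b), mul_assoc] at this
  · intro h a b
    have h1 := h (Pi.single b (scale ((ϖ : F) ^ m) b)) (fun x => ?_) a
    · simpa [mulVec_single, mul_assoc] using h1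
    · by_cases hx : x = b
      · subst hx
        simp [h0 x]
      · simp [hx]

theorem mem_J_iff (hϖ : IsUniformizer ϖ) (m : ℕ) (g : GL (Idx n) F) :
    g ∈ J n F m ↔ g ∈ SO n F ∧ IsAdapted ((ϖ : F) ^ m) (g : Matrix (Idx n) (Idx n) F) ∧
      IsAdapted ((ϖ : F) ^ m) ((g⁻¹ : GL (Idx n) F) : Matrix (Idx n) (Idx n) F) := by
  simp only [isAdapted_iff hϖ]
  constructor
  · intro hg
    exact ⟨hg.1, fun v hv => (hg.2 v).2 hv,
      fun v hv => ((Subgroup.inv_mem _ hg).2 v).2 hv⟩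
  · rintro ⟨h1, h2, h3⟩
    refine ⟨h1, fun v => ⟨fun hv => ?_, h2 v⟩⟩
    have := h3 _ hv
    rwa [Matrix.mulVec_mulVec, ← Units.val_mul, inv_mul_cancel, Units.val_one,
      Matrix.one_mulVec] at this

theorem weylElt_mem_J (hϖ : IsUniformizer ϖ) (m : ℕ) (j : Fin n) :
    weylElt j (ϖ ^ m) ∈ J n F m := by
  have h : IsAdapted ((ϖ : F) ^ m) (weylMat j (ϖ ^ m)) := by
    have h0 : (ϖ : F) ^ m ≠ 0 := pow_ne_zero _ ϖ.ne_zero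
    intro a b
    rw [← Matrix.mul_one (weylMat j (ϖ ^ m))]
    rcases idx_cases a with ⟨i, rfl⟩ | rfl | ⟨i, rfl⟩ <;>
      rcases idx_cases b with ⟨l, rfl⟩ | rfl | ⟨l, rfl⟩ <;>
      simp only [weylMat_mul_neg, weylMat_mul_pos, weylMat_mul_zero, scale_neg, scale_zero,
        scale_pos, Matrix.one_apply, neg_inj, pos_inj, neg_ne_pos, pos_ne_neg, zero_ne_pos,
        zero_ne_neg, pos_ne_zero, neg_ne_zero, if_true, if_false, Units.val_pow_eq_pow_val] <;>
      (try split_ifs) <;>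
      simp [h0]
  exact (mem_J_iff hϖ m _).2 ⟨weylElt_mem_SO j _, h, h⟩

theorem rootElt_mem_J (hϖ : IsUniformizer ϖ) (m : ℕ) (i j : Fin n) (y : 𝒪[F]) :
    rootElt i j (((ϖ : F) ^ m)⁻¹ * y) ∈ J n F m := by
  have h : ∀ y : 𝒪[F], IsAdapted ((ϖ : F) ^ m) (1 + rootMat i j (((ϖ : F) ^ m)⁻¹ * y)) := by
    have h0 : (ϖ : F) ^ m ≠ 0 := pow_ne_zero _ ϖ.ne_zero
    intro y a b
    have h1 : ((ϖ : F) ^ m)⁻¹ * y * (ϖ : F) ^ m = y := by field_simp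
    rcases idx_cases a with ⟨k, rfl⟩ | rfl | ⟨k, rfl⟩ <;>
      rcases idx_cases b with ⟨l, rfl⟩ | rfl | ⟨l, rfl⟩ <;>
      simp only [Matrix.add_apply, rootMat_row_pos, rootMat_row_zero, rootMat_neg_neg,
        rootMat_neg_zero, rootMat_neg_pos, scale_neg, scale_zero, scale_pos, Matrix.one_apply,
        neg_inj, pos_inj, neg_ne_pos, pos_ne_neg, zero_ne_pos, zero_ne_neg, pos_ne_zero,
        neg_ne_zero, if_true, if_false] <;>
      (try split_ifs) <;>
      simp [h0, h1]
  refine (mem_J_iff hϖ m _).2 ⟨rootElt_mem_SO i j _, h y, ?_⟩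
  have h1 := h (-y)
  rw [Subring.coe_neg, mul_neg] at h1
  exact h1

/-- The element `w_{S,m} ∏ x_β(ϖ^{-m} y_β)` stabilizes `L_m`, for every `S`. -/
theorem weylS_mul_rootProd_mem_J (hϖ : IsUniformizer ϖ) (m : ℕ) (S : Finset (Fin n))
    (y : rootSet S → 𝒪[F]) :
    weylS ϖ m S * rootProd S (fun β => ((ϖ : F) ^ m)⁻¹ * (y β : F)) ∈ J n F m :=
  Subgroup.mul_mem _
    (Subgroup.noncommProd_mem _ _ fun j _ => weylElt_mem_J hϖ m j)
    (Subgroup.noncommProd_mem _ _ fun _ _ => rootElt_mem_J hϖ m _ _ _)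

/-- Integral coordinates, with `t = ϖ ^ m`, of the columns of an element `g` of the stabilizer of
`L_m`, except for the column of `e_0`. -/
structure HasCoords (t : F) (g : GL (Idx n) F) (A b c D : Matrix (Fin n) (Fin n) 𝒪[F])
    (r s : Fin n → 𝒪[F]) : Prop where
  neg_neg : ∀ i j, g (neg i) (neg j) = A i j
  neg_pos : ∀ i j, g (neg i) (pos j) = t⁻¹ * b i j
  pos_neg : ∀ i j, g (pos i) (neg j) = t * c i j
  pos_pos : ∀ i j, g (pos i) (pos j) = D i j
  zero_neg : ∀ j, g zero (neg j) = t * r j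
  zero_pos : ∀ j, g zero (pos j) = s j

theorem exists_hasCoords (hϖ : IsUniformizer ϖ) {m : ℕ} {g : GL (Idx n) F} (hg : g ∈ J n F m) :
    ∃ A b c D r s, HasCoords ((ϖ : F) ^ m) g A b c D r s := by
  have h0 : (ϖ : F) ^ m ≠ 0 := pow_ne_zero _ ϖ.ne_zero
  have h := ((mem_J_iff hϖ m g).1 hg).2.1
  refine ⟨Matrix.of fun i j => ⟨_, h (neg i) (neg j)⟩, Matrix.of fun i j => ⟨_, h (neg i) (pos j)⟩,
    Matrix.of fun i j => ⟨_, h (pos i) (neg j)⟩, Matrix.of fun i j => ⟨_, h (pos i) (pos j)⟩,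
    fun j => ⟨_, h zero (neg j)⟩, fun j => ⟨_, h zero (pos j)⟩, ?_, ?_, ?_, ?_, ?_, ?_⟩ <;>
    intros <;> simp only [Matrix.of_apply, scale_neg, scale_zero, scale_pos] <;> field_simp

end Integral

/-! ### The Lagrangian subspace and the determinant condition -/

section Integral

open Matrix

variable {n : ℕ} {F : Type*} [Field F] [ValuativeRel F] {ϖ : Fˣ}

theorem integer_coe_two : ((2 : 𝒪[F]) : F) = 2 := rfl

namespace HasCoords

variable {t : 𝒪[F]} {g h : GL (Idx n) F} {A b c D A' b' c' D' : Matrix (Fin n) (Fin n) 𝒪[F]}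
  {r s r' s' : Fin n → 𝒪[F]}

theorem mul_inv_mul_neg_pos (ht : (t : F) ≠ 0) (hg : g ∈ SO n F)
    (H : HasCoords (t : F) g A b c D r s) (H' : HasCoords (t : F) h A' b' c' D' r' s')
    (i j : Fin n) :
    (t : F) * (g⁻¹ * h : GL (Idx n) F) (neg i) (pos j) =
      ((pairing b D b' D' i j + 2 * t * (s i * s' j) : 𝒪[F]) : F) := by
  rw [inv_mul_neg hg]
  simp only [H.pos_pos, H.neg_pos, H.zero_pos, H'.pos_pos, H'.neg_pos, H'.zero_pos, pairing,
    Matrix.add_apply, Matrix.mul_apply, Matrix.transpose_apply, Subring.coe_add,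
    Subring.coe_mul, AddSubmonoidClass.coe_finsetSum, mul_add, Finset.mul_sum]
  have h1 : ∀ x y : F, (t : F) * (x * ((t : F)⁻¹ * y)) = x * y := fun x y => by field_simp
  have h2 : ∀ x y : F, (t : F) * ((t : F)⁻¹ * x * y) = x * y := fun x y => by field_simp
  simp only [h1, h2]
  push_cast [integer_coe_two]
  ring

theorem pairing_self (ht : (t : F) ≠ 0) (hg : g ∈ SO n F)
    (H : HasCoords (t : F) g A b c D r s) (i j : Fin n) :
    pairing b D b D i j + 2 * t * (s i * s j) = 0 := by
  have h1 := mul_inv_mul_neg_pos ht hg H H i j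
  rw [inv_mul_cancel, Units.val_one, Matrix.one_apply_ne (neg_ne_pos _ _), mul_zero] at h1
  exact Subtype.ext h1.symm

theorem mul_add_mul_eq_one (ht : (t : F) ≠ 0) (hg : g ∈ SO n F)
    (H : HasCoords (t : F) g A b c D r s) :
    Aᵀ * D + cᵀ * b + (2 * t) • vecMulVec r s = 1 := by
  ext i j
  have h1 := inv_mul_pos hg g i (pos j)
  rw [inv_mul_cancel, Units.val_one] at h1
  have h2 : ∀ x y : F, (t : F) * x * ((t : F)⁻¹ * y) = x * y := fun x y => by field_simp
  simp only [H.pos_pos, H.neg_neg, H.neg_pos, H.pos_neg, H.zero_pos, H.zero_neg, h2] at h1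
  have h3 : (((1 : Matrix (Fin n) (Fin n) 𝒪[F]) i j : 𝒪[F]) : F) =
      (1 : Matrix (Idx n) (Idx n) F) (pos i) (pos j) := by
    simp only [Matrix.one_apply, pos_inj]
    split_ifs <;> rfl
  rw [h3, h1]
  simp only [Matrix.add_apply, Matrix.mul_apply, Matrix.transpose_apply, Matrix.smul_apply,
    vecMulVec_apply, smul_eq_mul, Subring.coe_add, Subring.coe_mul,
    AddSubmonoidClass.coe_finsetSum]
  push_cast [integer_coe_two]
  ring

theorem mul_add_mul_eq_zero (ht : (t : F) ≠ 0) (hg : g ∈ SO n F)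
    (H : HasCoords (t : F) g A b c D r s) :
    Aᵀ * c + cᵀ * A + (2 * t) • vecMulVec r r = 0 := by
  ext i j
  have h1 := inv_mul_pos hg g i (neg j)
  rw [inv_mul_cancel, Units.val_one, Matrix.one_apply_ne (pos_ne_neg _ _)] at h1
  have h2 : ∀ x y : F, x * ((t : F) * y) = (t : F) * (x * y) := fun x y => by ring
  simp only [H.neg_neg, H.pos_neg, H.zero_neg, h2, mul_assoc (t : F), ← Finset.mul_sum] at h1
  apply mul_left_cancel₀ ht
  simp only [Matrix.add_apply, Matrix.mul_apply, Matrix.transpose_apply, Matrix.smul_apply,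
    vecMulVec_apply, smul_eq_mul, Subring.coe_add, Subring.coe_mul,
    AddSubmonoidClass.coe_finsetSum, Matrix.zero_apply, Subring.coe_zero, mul_zero]
  push_cast [integer_coe_two]
  rw [h1]
  ring

/-- The minor `hypDet` can be computed in integral coordinates. -/
theorem hypDet_eq_det (ht : (t : F) ≠ 0) (H : HasCoords (t : F) g A b c D r s) :
    hypDet g = ((fromBlocks A b c D).det : 𝒪[F]) := by
  let f : Fin n ⊕ Fin n → {a : Idx n // a ≠ zero} :=
    Sum.elim (fun i => ⟨neg i, neg_ne_zero i⟩) (fun i => ⟨pos i, pos_ne_zero i⟩)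
  have hf : Function.Bijective f := by
    constructor
    · rintro (i | i) (j | j) hij
      · exact congrArg _ (neg_inj.1 (congrArg Subtype.val hij))
      · exact absurd (congrArg Subtype.val hij) (neg_ne_pos i j)
      · exact absurd (congrArg Subtype.val hij) (pos_ne_neg i j)
      · exact congrArg _ (pos_inj.1 (congrArg Subtype.val hij))
    · rintro ⟨a, ha⟩
      rcases idx_cases a with ⟨i, rfl⟩ | rfl | ⟨i, rfl⟩
      exacts [⟨Sum.inl i, rfl⟩, absurd rfl ha, ⟨Sum.inr i, rfl⟩]
  have h1 : hypDet g = (fromBlocks (A.map (algebraMap 𝒪[F] F))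
      ((t : F)⁻¹ • b.map (algebraMap 𝒪[F] F)) ((t : F) • c.map (algebraMap 𝒪[F] F))
      (D.map (algebraMap 𝒪[F] F))).det := by
    rw [hypDet, ← Matrix.det_submatrix_equiv_self (Equiv.ofBijective f hf)]
    congr 1
    ext i j
    rcases i with i | i <;> rcases j with j | j
    exacts [H.neg_neg i j, H.neg_pos i j, H.pos_neg i j, H.pos_pos i j]
  have h2 : (((fromBlocks A b c D).det : 𝒪[F]) : F) = (fromBlocks (A.map (algebraMap 𝒪[F] F))
      (b.map (algebraMap 𝒪[F] F)) (c.map (algebraMap 𝒪[F] F))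
      (D.map (algebraMap 𝒪[F] F))).det := by
    rw [← fromBlocks_map]
    exact RingHom.map_det (algebraMap 𝒪[F] F) _
  -- the two block matrices are conjugate under `diag (1, t)`
  have h3 : ∀ A b c D : Matrix (Fin n) (Fin n) F,
      fromBlocks A ((t : F)⁻¹ • b) ((t : F) • c) D * fromBlocks 1 0 0 ((t : F) • 1) =
        fromBlocks 1 0 0 ((t : F) • 1) * fromBlocks A b c D := by
    intro A b c D
    simp [fromBlocks_multiply, smul_smul, ht]
  have h4 := congrArg det (h3 (A.map (algebraMap 𝒪[F] F)) (b.map (algebraMap 𝒪[F] F))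
    (c.map (algebraMap 𝒪[F] F)) (D.map (algebraMap 𝒪[F] F)))
  rw [det_mul, det_mul, mul_comm] at h4
  rw [h1, h2]
  refine mul_left_cancel₀ ?_ h4
  simp [ht]

/-- If the block `A` is invertible, its Schur complement differs from the transposed inverse of
`A` by twice a matrix of rank one, so that `hypDet g` is explicit. This replaces the triviality of
the Dickson invariant on the Siegel parabolic subgroup. -/
theorem exists_hypDet_sub_one (ht : (t : F) ≠ 0) (hg : g ∈ SO n F)
    (H : HasCoords (t : F) g A b c D r s) (hA : IsUnit A.det) :
    ∃ z : 𝒪[F], hypDet g - 1 = 2 * ((t * z : 𝒪[F]) : F) := by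
  let _ := A.invertibleOfIsUnitDet hA
  have h1 := mul_add_mul_eq_one ht hg H
  have h2 := mul_add_mul_eq_zero ht hg H
  have h3 : Aᵀ * (D - c * ⅟A * b) =
      1 + replicateCol Unit r * replicateRow Unit (-(2 * t) • (s - r ᵥ* (⅟A * b))) := by
    have h4 : Aᵀ * c * (⅟A * b) = -(cᵀ * b) - (2 * t) • (vecMulVec r r * (⅟A * b)) := by
      have h5 : Aᵀ * c = -(cᵀ * A) - (2 * t) • vecMulVec r r := by
        rw [← sub_eq_zero, ← h2]
        abel
      rw [h5, Matrix.sub_mul, Matrix.neg_mul, Matrix.smul_mul, Matrix.mul_assoc cᵀ,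
        ← Matrix.mul_assoc A, mul_invOf_self, Matrix.one_mul]
    have h6 : replicateCol Unit r * replicateRow Unit (-(2 * t) • (s - r ᵥ* (⅟A * b))) =
        -((2 * t) • vecMulVec r s) + (2 * t) • (vecMulVec r r * (⅟A * b)) := by
      rw [← vecMulVec_eq, vecMulVec_mul, vecMulVec_smul, vecMulVec_sub, smul_sub, neg_smul,
        neg_smul]
      abel
    rw [Matrix.mul_sub, Matrix.mul_assoc c, ← Matrix.mul_assoc Aᵀ, h4, h6, ← h1]
    abel
  have h5 : (fromBlocks A b c D).det =
      1 + (-(2 * t) • (s - r ᵥ* (⅟A * b))) ⬝ᵥ r := by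
    rw [det_fromBlocks₁₁, ← det_transpose A, ← det_mul, h3,
      det_one_add_replicateCol_mul_replicateRow]
  refine ⟨-((s - r ᵥ* (⅟A * b)) ⬝ᵥ r), ?_⟩
  rw [H.hypDet_eq_det ht, h5, smul_dotProduct]
  push_cast
  simp only [smul_eq_mul]
  push_cast [integer_coe_two]
  ring

end HasCoords

/-- For elements of the stabilizer of `L_{m+1}`, stabilizing `L_m` too is a condition on one block:
with `t = ϖ ^ (m + 1)`, the block `t⁻¹ * b` has to be divisible by `ϖ * t⁻¹`. -/
theorem mem_J_iff_of_mem_J_succ (hϖ : IsUniformizer ϖ) {m : ℕ} {g : GL (Idx n) F}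
    (hg : g ∈ J n F (m + 1)) :
    g ∈ J n F m ↔ ∀ i j, (ϖ : F) ^ m * g (neg i) (pos j) ∈ 𝒪[F] := by
  have h0 : (ϖ : F) ^ m ≠ 0 := pow_ne_zero _ ϖ.ne_zero
  have h0' : (ϖ : F) ^ (m + 1) ≠ 0 := pow_ne_zero _ ϖ.ne_zero
  have key : ∀ g ∈ J n F (m + 1), (∀ i j, (ϖ : F) ^ m * g (neg i) (pos j) ∈ 𝒪[F]) →
      IsAdapted ((ϖ : F) ^ m) (g : Matrix (Idx n) (Idx n) F) := by
    intro g hg hB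
    obtain ⟨hSO, hM, hM'⟩ := (mem_J_iff hϖ _ _).1 hg
    have hlow : ∀ x : F, ((ϖ : F) ^ (m + 1))⁻¹ * x * 1 ∈ 𝒪[F] →
        ((ϖ : F) ^ m)⁻¹ * x * 1 ∈ 𝒪[F] := fun x hx => by
      have := Subring.mul_mem _ hϖ.mem_integer hx
      convert this using 1
      have := ϖ.ne_zero
      field_simp
      ring
    have hdiag : ∀ x : F, ((ϖ : F) ^ (m + 1))⁻¹ * x * (ϖ : F) ^ (m + 1) ∈ 𝒪[F] →
        x ∈ 𝒪[F] := fun x hx => by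
      rwa [mul_right_comm, inv_mul_cancel₀ h0', one_mul] at hx
    have hdiag' : ∀ x : F, ((ϖ : F) ^ (m + 1))⁻¹ * x * (ϖ : F) ^ (m + 1) ∈ 𝒪[F] →
        ((ϖ : F) ^ m)⁻¹ * x * (ϖ : F) ^ m ∈ 𝒪[F] := fun x hx => by
      rw [mul_right_comm, inv_mul_cancel₀ h0, one_mul]
      exact hdiag x hx
    intro a b
    have hab := hM a b
    rcases idx_cases a with ⟨k, rfl⟩ | rfl | ⟨k, rfl⟩ <;>
      rcases idx_cases b with ⟨l, rfl⟩ | rfl | ⟨l, rfl⟩ <;>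
      simp only [scale_neg, scale_zero, scale_pos] at hab ⊢
    · exact hab
    · have h1 := hdiag _ (hM' zero (pos k))
      rw [apply_neg_zero hSO, inv_one, one_mul, two_mul, add_mul]
      exact Subring.add_mem _ (Subring.mul_mem _ h1 (hϖ.pow_mem m))
        (Subring.mul_mem _ h1 (hϖ.pow_mem m))
    · rw [inv_one, one_mul, mul_comm]
      exact hB k l
    · exact hlow _ hab
    · exact hdiag' _ hab
    · exact hdiag' _ hab
    · exact hlow _ hab
    · exact hdiag' _ hab
    · exact hdiag' _ hab
  constructor
  · intro h i j
    have h1 := ((mem_J_iff hϖ _ _).1 h).2.1 (neg i) (pos j)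
    rwa [scale_neg, scale_pos, inv_one, one_mul, mul_comm] at h1
  · intro h
    refine (mem_J_iff hϖ _ _).2 ⟨hg.1, key g hg h, key _ (Subgroup.inv_mem _ hg) fun i j => ?_⟩
    rw [inv_neg_pos hg.1]
    exact h j i

section Residue

variable {m : ℕ} {g h : GL (Idx n) F} {A b c D A' b' c' D' : Matrix (Fin n) (Fin n) 𝒪[F]}
  {r s r' s' : Fin n → 𝒪[F]}

theorem IsUniformizer.residue_pow_succ (hϖ : IsUniformizer ϖ) (m : ℕ) :
    IsLocalRing.residue 𝒪[F] ⟨(ϖ : F) ^ (m + 1), hϖ.pow_mem (m + 1)⟩ = 0 := by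
  rw [hϖ.residue_eq_zero_iff]
  change (ϖ : F)⁻¹ * (ϖ : F) ^ (m + 1) ∈ 𝒪[F]
  rw [pow_succ', inv_mul_cancel_left₀ ϖ.ne_zero]
  exact hϖ.pow_mem m

theorem pairing_map {R R' : Type*} [CommRing R] [CommRing R'] (f : R →+* R')
    (b D b' D' : Matrix (Fin n) (Fin n) R) :
    pairing (b.map f) (D.map f) (b'.map f) (D'.map f) = (pairing b D b' D').map f := by
  ext i j
  simp [pairing, Matrix.mul_apply]

/-- Modulo `𝔭`, the `b` and `D` blocks of `g` describe the image under `g` of the Lagrangian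
subspace of `L_{m+1} / (𝔭^{m+1} e_0 + 𝔭 L_{m+1})` stabilized by `J_{n,m} ∩ J_{n,m+1}`, namely the
image of `𝔭 L_m`. Two cosets agree when these subspaces are orthogonal, hence equal. -/
theorem inv_mul_mem_J_iff (hϖ : IsUniformizer ϖ) (hg : g ∈ J n F (m + 1))
    (hh : h ∈ J n F (m + 1)) (H : HasCoords ((ϖ : F) ^ (m + 1)) g A b c D r s)
    (H' : HasCoords ((ϖ : F) ^ (m + 1)) h A' b' c' D' r' s') :
    g⁻¹ * h ∈ J n F m ↔
      pairing (b.map (IsLocalRing.residue 𝒪[F])) (D.map (IsLocalRing.residue 𝒪[F]))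
        (b'.map (IsLocalRing.residue 𝒪[F])) (D'.map (IsLocalRing.residue 𝒪[F])) = 0 := by
  have h0 : (ϖ : F) ^ (m + 1) ≠ 0 := pow_ne_zero _ ϖ.ne_zero
  rw [mem_J_iff_of_mem_J_succ hϖ (Subgroup.mul_mem _ (Subgroup.inv_mem _ hg) hh), pairing_map,
    ← Matrix.ext_iff]
  refine forall_congr' fun i => forall_congr' fun j => ?_
  have h1 := HasCoords.mul_inv_mul_neg_pos
    (t := ⟨(ϖ : F) ^ (m + 1), hϖ.pow_mem (m + 1)⟩) h0 hg.1 H H' i j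
  have h2 : (ϖ : F) ^ m * (g⁻¹ * h : GL (Idx n) F) (neg i) (pos j) =
      (ϖ : F)⁻¹ * ((ϖ : F) ^ (m + 1) * (g⁻¹ * h : GL (Idx n) F) (neg i) (pos j)) := by
    rw [pow_succ', mul_assoc, inv_mul_cancel_left₀ ϖ.ne_zero]
  rw [h2, h1, ← hϖ.residue_eq_zero_iff, map_add, map_mul, map_mul, hϖ.residue_pow_succ]
  simp

theorem HasCoords.isLagrangian (hϖ : IsUniformizer ϖ) [CharZero F] (hg : g ∈ J n F (m + 1))
    (H : HasCoords ((ϖ : F) ^ (m + 1)) g A b c D r s) :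
    IsLagrangian (b.map (IsLocalRing.residue 𝒪[F])) (D.map (IsLocalRing.residue 𝒪[F])) := by
  have h0 : (ϖ : F) ^ (m + 1) ≠ 0 := pow_ne_zero _ ϖ.ne_zero
  have ht := hϖ.residue_pow_succ m
  have h1 := HasCoords.pairing_self (t := ⟨(ϖ : F) ^ (m + 1), hϖ.pow_mem (m + 1)⟩) h0 hg.1 H
  have h2 := HasCoords.mul_add_mul_eq_one
    (t := ⟨(ϖ : F) ^ (m + 1), hϖ.pow_mem (m + 1)⟩) h0 hg.1 H
  generalize (⟨(ϖ : F) ^ (m + 1), hϖ.pow_mem (m + 1)⟩ : 𝒪[F]) = t at ht h1 h2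
  have h4 : ((D.map (IsLocalRing.residue 𝒪[F]))ᵀ * b.map (IsLocalRing.residue 𝒪[F])) =
      (Dᵀ * b).map (IsLocalRing.residue 𝒪[F]) := by
    rw [Matrix.map_mul, Matrix.transpose_map]
  have h5 : ∀ i j, (bᵀ * D) i j = (Dᵀ * b) j i := fun i j => by
    rw [← Matrix.transpose_apply (Dᵀ * b), Matrix.transpose_mul, Matrix.transpose_transpose]
  constructor
  · intro u hb hD
    have h3 : (A.map (IsLocalRing.residue 𝒪[F]))ᵀ * D.map (IsLocalRing.residue 𝒪[F]) +
        (c.map (IsLocalRing.residue 𝒪[F]))ᵀ * b.map (IsLocalRing.residue 𝒪[F]) = 1 := by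
      have := congrArg (fun M => M.map (IsLocalRing.residue 𝒪[F])) h2
      ext i j
      have := congrFun (congrFun this i) j
      simp only [Matrix.map_apply, Matrix.add_apply, Matrix.smul_apply, smul_eq_mul, map_add,
        map_mul, ht, mul_zero, zero_mul, add_zero, Matrix.mul_apply, map_sum,
        Matrix.transpose_apply, Matrix.one_apply] at this ⊢
      rw [this]
      split_ifs <;> simp
    rw [← Matrix.one_mulVec u, ← h3, Matrix.add_mulVec, ← Matrix.mulVec_mulVec,
      ← Matrix.mulVec_mulVec, hb, hD]
    simp
  · rw [h4]
    constructor
    · intro i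
      -- the diagonal entries of `Dᵀ * b` are half those of `pairing b D b D`
      have h6 : (Dᵀ * b) i i = -(t * (s i * s i)) := by
        have h7 := h1 i i
        rw [pairing, Matrix.add_apply, h5] at h7
        have h8 : (2 : F) * (((Dᵀ * b) i i + t * (s i * s i) : 𝒪[F]) : F) = 0 := by
          have := congrArg (Subtype.val : 𝒪[F] → F) h7
          push_cast [integer_coe_two] at this ⊢
          linear_combination this
        exact eq_neg_of_add_eq_zero_left
          (Subtype.ext ((mul_eq_zero.1 h8).resolve_left two_ne_zero))
      rw [Matrix.map_apply, h6, map_neg, map_mul, ht, zero_mul, neg_zero]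
    · intro i j
      have h7 := h1 i j
      rw [pairing, Matrix.add_apply, h5] at h7
      have h8 := congrArg (IsLocalRing.residue 𝒪[F]) h7
      rw [map_add, map_add, map_mul, map_mul, ht, map_zero] at h8
      rw [Matrix.map_apply, Matrix.map_apply]
      linear_combination h8

/-- For `g ∈ J_{n,m} ∩ J_{n,m+1}` the entry at `e_0`, which is `hypDet g`, is congruent to `1` modulo
`2𝔭`. In the reduction, the Siegel parabolic subgroup of the orthogonal group lies in the special
orthogonal group. -/
theorem exists_zero_zero_sub_one [CharZero F] (hϖ : IsUniformizer ϖ) (hg : g ∈ J n F (m + 1))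
    (hg' : g ∈ J n F m) : ∃ z ∈ 𝒪[F], g zero zero - 1 = 2 * ((ϖ : F) * z) := by
  have h0 : (ϖ : F) ^ (m + 1) ≠ 0 := pow_ne_zero _ ϖ.ne_zero
  obtain ⟨A, b, c, D, r, s, H⟩ := exists_hasCoords hϖ hg
  have ht := hϖ.residue_pow_succ m
  have h2 := HasCoords.mul_add_mul_eq_one
    (t := ⟨(ϖ : F) ^ (m + 1), hϖ.pow_mem (m + 1)⟩) h0 hg.1 H
  have hb : ∀ i j, IsLocalRing.residue 𝒪[F] (b i j) = 0 := fun i j => by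
    rw [hϖ.residue_eq_zero_iff]
    have := (mem_J_iff_of_mem_J_succ hϖ hg).1 hg' i j
    rw [H.neg_pos] at this
    convert this using 1
    have := ϖ.ne_zero
    field_simp
    ring
  have hA : IsUnit A.det := by
    rw [← IsLocalRing.residue_ne_zero_iff_isUnit]
    have h3 : ((A.map (IsLocalRing.residue 𝒪[F]))ᵀ * D.map (IsLocalRing.residue 𝒪[F])) = 1 := by
      ext i j
      have := congrArg (IsLocalRing.residue 𝒪[F]) (congrFun (congrFun h2 i) j)
      simp only [Matrix.map_apply, Matrix.add_apply, Matrix.smul_apply, smul_eq_mul, map_add,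
        map_mul, ht, hb, mul_zero, zero_mul, add_zero, Matrix.mul_apply, map_sum,
        Matrix.transpose_apply, Matrix.one_apply, Finset.sum_const_zero] at this ⊢
      rw [this]
      split_ifs <;> simp
    have h4 := congrArg det h3
    rw [det_mul, det_transpose, det_one] at h4
    have h5 := RingHom.map_det (IsLocalRing.residue 𝒪[F]) A
    rw [RingHom.mapMatrix_apply] at h5
    rw [h5]
    exact left_ne_zero_of_mul_eq_one h4
  obtain ⟨z, hz⟩ := HasCoords.exists_hypDet_sub_one
    (t := ⟨(ϖ : F) ^ (m + 1), hϖ.pow_mem (m + 1)⟩) h0 hg.1 H hA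
  refine ⟨(ϖ : F) ^ m * z, Subring.mul_mem _ (hϖ.pow_mem m) z.2, ?_⟩
  rw [← hypDet_eq hg.1, hz]
  push_cast [integer_coe_two]
  ring

end Residue

end Integral

/-! ### The coset representatives -/

section Cosets

open Matrix

variable {n : ℕ} {F : Type*} [Field F] [ValuativeRel F] {ϖ : Fˣ}

theorem rep_mem_J (hϖ : IsUniformizer ϖ) (m : ℕ) (S : Finset (Fin n)) (y : rootSet S → 𝒪[F]) :
    rep ϖ m S y ∈ J n F (m + 1) :=
  weylS_mul_rootProd_mem_J hϖ (m + 1) S y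

theorem rep_zero (m : ℕ) (S : Finset (Fin n)) (y : rootSet S → 𝒪[F]) (b : Idx n) :
    rep ϖ m S y zero b = (-1) ^ S.card * (1 : Matrix (Idx n) (Idx n) F) zero b := by
  rw [rep, (weylS_mul_apply ϖ (m + 1) S _ b).2.2, rootProd_zero]

theorem rep_mem_K [CharZero F] (hϖ : IsUniformizer ϖ) (m : ℕ) (S : Finset (Fin n))
    (hS : Even S.card) (y : rootSet S → 𝒪[F]) : rep ϖ m S y ∈ K n F (m + 1) := by
  have hJ := rep_mem_J hϖ m S y
  refine ⟨hJ, fun _ => ⟨0, Submodule.zero_mem _, ?_⟩⟩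
  rw [hypDet_eq hJ.1, rep_zero, hS.neg_one_pow]
  simp

/-- Integral coordinates of a representative: it maps the standard Lagrangian subspace to the one
with the reduced echelon basis described by `S` and by the alternating matrix of `y`. -/
theorem exists_hasCoords_rep (hϖ : IsUniformizer ϖ) (m : ℕ) (S : Finset (Fin n))
    (y : rootSet S → 𝒪[F]) :
    ∃ A c r s, HasCoords ((ϖ : F) ^ (m + 1)) (rep ϖ m S y) A
      (flipNeg S (altMat S y) 1) c (flipPos S (altMat S y) 1) r s := by
  have h0 : (ϖ : F) ^ (m + 1) ≠ 0 := pow_ne_zero _ ϖ.ne_zero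
  obtain ⟨A, b, c, D, r, s, H⟩ := exists_hasCoords hϖ (rep_mem_J hϖ m S y)
  have hone : ∀ i j, (1 : Matrix (Idx n) (Idx n) F) (pos i) (pos j) =
      (((1 : Matrix (Fin n) (Fin n) 𝒪[F]) i j : 𝒪[F]) : F) := fun i j => by
    simp only [Matrix.one_apply, pos_inj]
    split_ifs <;> rfl
  have halt : ∀ i j, altMat S (fun β => ((ϖ : F) ^ (m + 1))⁻¹ * (y β : F)) i j =
      ((ϖ : F) ^ (m + 1))⁻¹ * ((altMat S y i j : 𝒪[F]) : F) := fun i j => by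
    have h1 : ((altMat S y i j : 𝒪[F]) : F) = altMat S (fun β => (y β : F)) i j :=
      congrFun (congrFun (altMat_map (algebraMap 𝒪[F] F) y) i) j
    rw [h1]
    simp only [altMat, Matrix.of_apply, Finset.mul_sum, mul_sub, mul_ite, mul_zero]
  refine ⟨A, c, r, s, ⟨H.neg_neg, fun i j => ?_, H.pos_neg, fun i j => ?_, H.zero_neg,
    H.zero_pos⟩⟩
  · rw [rep, (weylS_mul_apply ϖ (m + 1) S _ _).1, rootProd_pos, rootProd_neg_pos, halt, hone]
    by_cases hi : i ∈ S <;> simp [flipNeg, hi]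
  · rw [rep, (weylS_mul_apply ϖ (m + 1) S _ _).2.1, rootProd_pos, rootProd_neg_pos, halt, hone]
    by_cases hi : i ∈ S <;> simp [flipPos, hi, h0]

theorem flipNeg_map {R R' : Type*} [CommRing R] [CommRing R'] (f : R →+* R')
    (S : Finset (Fin n)) (y : rootSet S → R) :
    (flipNeg S (altMat S y) 1).map f = flipNeg S (altMat S fun β => f (y β)) 1 := by
  rw [← altMat_map]
  ext i j
  by_cases hi : i ∈ S <;> simp [flipNeg, hi, Matrix.one_apply, apply_ite f]

theorem flipPos_map {R R' : Type*} [CommRing R] [CommRing R'] (f : R →+* R')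
    (S : Finset (Fin n)) (y : rootSet S → R) :
    (flipPos S (altMat S y) 1).map f = flipPos S (altMat S fun β => f (y β)) 1 := by
  rw [← altMat_map]
  ext i j
  by_cases hi : i ∈ S <;> simp [flipPos, hi, Matrix.one_apply, apply_ite f]

/-- Distinct data give elements in distinct cosets of `J_{n,m} ∩ J_{n,m+1}`. -/
theorem eq_of_inv_mul_rep_mem_J (hϖ : IsUniformizer ϖ) {m : ℕ} {S S' : Finset (Fin n)}
    {y : rootSet S → 𝒪[F]} {y' : rootSet S' → 𝒪[F]}
    (h : (rep ϖ m S y)⁻¹ * rep ϖ m S' y' ∈ J n F m) :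
    S = S' ∧ altMat S (fun β => IsLocalRing.residue 𝒪[F] (y β)) =
      altMat S' (fun β => IsLocalRing.residue 𝒪[F] (y' β)) := by
  obtain ⟨A, c, r, s, H⟩ := exists_hasCoords_rep hϖ m S y
  obtain ⟨A', c', r', s', H'⟩ := exists_hasCoords_rep hϖ m S' y'
  rw [inv_mul_mem_J_iff hϖ (rep_mem_J hϖ m S y) (rep_mem_J hϖ m S' y') H H', flipNeg_map,
    flipNeg_map, flipPos_map, flipPos_map] at h
  exact echelon_unique (isAlternating_altMat _) (altMat_eq_zero _) (isAlternating_altMat _)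
    (altMat_eq_zero _) h

/-- Every element of `J_{n,m+1}` lies in the coset of a representative, for a set `S` of any
parity, which depends only on the reduction of the parameters. -/
theorem exists_inv_rep_mul_mem_J [CharZero F] (hϖ : IsUniformizer ϖ) {m : ℕ} {g : GL (Idx n) F}
    (hg : g ∈ J n F (m + 1)) :
    ∃ (S : Finset (Fin n)) (z : rootSet S → 𝓀[F]), ∀ y : rootSet S → 𝒪[F],
      (∀ β, IsLocalRing.residue 𝒪[F] (y β) = z β) → (rep ϖ m S y)⁻¹ * g ∈ J n F m := by
  obtain ⟨A, b, c, D, r, s, H⟩ := exists_hasCoords hϖ hg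
  obtain ⟨S, Y, hY, hYS, hp⟩ := (H.isLagrangian hϖ hg).exists_echelon
  refine ⟨S, fun β => Y β.1.1 β.1.2, fun y hy => ?_⟩
  obtain ⟨A', c', r', s', H'⟩ := exists_hasCoords_rep hϖ m S y
  rw [inv_mul_mem_J_iff hϖ (rep_mem_J hϖ m S y) hg H' H, flipNeg_map, flipPos_map]
  simp only [hy]
  rwa [← eq_altMat hY hYS]

/-- The sign `(-1) ^ |S|` is the Dickson invariant of a representative. -/
theorem even_card_of_mem_K [CharZero F] (hϖ : IsUniformizer ϖ) {m : ℕ} {S : Finset (Fin n)}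
    {y : rootSet S → 𝒪[F]} {g : GL (Idx n) F} (hg : g ∈ K n F (m + 1))
    (h : (rep ϖ m S y)⁻¹ * g ∈ J n F m) : Even S.card := by
  by_contra hodd
  rw [Nat.not_even_iff_odd] at hodd
  obtain ⟨z, hz, hz'⟩ := exists_zero_zero_sub_one hϖ
    (Subgroup.mul_mem _ (Subgroup.inv_mem _ (rep_mem_J hϖ m S y)) hg.1) h
  obtain ⟨w, hw, hw'⟩ := hg.2 (Nat.succ_pos m)
  rw [hϖ.mem_pPow_iff] at hw
  have h1 : g zero zero = -((rep ϖ m S y)⁻¹ * g : GL (Idx n) F) zero zero := by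
    conv_lhs => rw [← mul_inv_cancel_left (rep ϖ m S y) g]
    rw [Units.val_mul, Matrix.mul_apply, Finset.sum_eq_single zero]
    · rw [rep_zero, hodd.neg_one_pow]
      simp
    · intro b _ hb
      rw [rep_zero, Matrix.one_apply_ne hb.symm, mul_zero, zero_mul]
    · simp
  rw [hypDet_eq hg.1.1, h1] at hw'
  -- `1` would be divisible by `ϖ`
  have h2 : (ϖ : F)⁻¹ * ((1 : 𝒪[F]) : F) =
      -(z + (ϖ : F) ^ m * (((ϖ : F) ^ (m + 1))⁻¹ * w)) := by
    have h3 : (ϖ : F) ^ m * (((ϖ : F) ^ (m + 1))⁻¹ * w) = (ϖ : F)⁻¹ * w := by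
      have := ϖ.ne_zero
      field_simp
      ring
    have h4 : (2 : F) * (1 + ϖ * z + w) = 0 := by linear_combination -hz' - hw'
    have h5 := (mul_eq_zero.1 h4).resolve_left two_ne_zero
    have h6 := inv_mul_cancel_left₀ ϖ.ne_zero z
    rw [h3, Subring.coe_one]
    linear_combination (ϖ : F)⁻¹ * h5 - h6
  have h3 := (hϖ.residue_eq_zero_iff 1).2 (by
    rw [h2]
    exact Subring.neg_mem _ (Subring.add_mem _ hz (Subring.mul_mem _ (hϖ.pow_mem m) hw)))
  rw [map_one] at h3
  exact one_ne_zero h3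

/-- Inside `K_{n,m+1}` the determinant condition that defines `K_{n,m}` is automatic. -/
theorem mem_K_inf_iff [CharZero F] (hϖ : IsUniformizer ϖ) {m : ℕ} {g : GL (Idx n) F}
    (hg : g ∈ K n F (m + 1)) : g ∈ K n F m ⊓ K n F (m + 1) ↔ g ∈ J n F m := by
  refine ⟨fun h => h.1.1, fun h => ⟨⟨h, fun _ => ?_⟩, hg⟩⟩
  obtain ⟨t, ht, ht'⟩ := hg.2 (Nat.succ_pos m)
  refine ⟨t, ?_, ht'⟩
  rw [hϖ.mem_pPow_iff] at ht ⊢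
  have := Subring.mul_mem _ hϖ.mem_integer ht
  convert this using 1
  have := ϖ.ne_zero
  field_simp
  ring

end Cosets

end OddOrthogonal

theorem proposition4p1 {F : Type*} [Field F] [CharZero F] [ValuativeRel F] [TopologicalSpace F]
    [IsNonarchimedeanLocalField F] (n m : ℕ) (ϖ : Fˣ) (hϖ : OddOrthogonal.IsUniformizer ϖ)
    (lift : ∀ a : OddOrthogonal.Label n F, OddOrthogonal.rootSet a.1.1 → 𝒪[F])
    (hlift : ∀ (a : OddOrthogonal.Label n F) (β : OddOrthogonal.rootSet a.1.1),
      IsLocalRing.residue 𝒪[F] (lift a β) = a.2 β) :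
    ∃ hmem : ∀ a : OddOrthogonal.Label n F,
        OddOrthogonal.rep ϖ m a.1.1 (lift a) ∈ OddOrthogonal.K n F (m + 1),
      Function.Bijective (fun a : OddOrthogonal.Label n F =>
        (QuotientGroup.mk
            (⟨OddOrthogonal.rep ϖ m a.1.1 (lift a), hmem a⟩ : OddOrthogonal.K n F (m + 1)) :
          OddOrthogonal.K n F (m + 1) ⧸
            (OddOrthogonal.K n F m ⊓ OddOrthogonal.K n F (m + 1)).subgroupOf
              (OddOrthogonal.K n F (m + 1)))) := by
  have hmem : ∀ a : OddOrthogonal.Label n F,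
      OddOrthogonal.rep ϖ m a.1.1 (lift a) ∈ OddOrthogonal.K n F (m + 1) :=
    fun a => OddOrthogonal.rep_mem_K hϖ m a.1.1 a.1.2 (lift a)
  have hcoset : ∀ g h : OddOrthogonal.K n F (m + 1),
      (QuotientGroup.mk g : OddOrthogonal.K n F (m + 1) ⧸
        (OddOrthogonal.K n F m ⊓ OddOrthogonal.K n F (m + 1)).subgroupOf
          (OddOrthogonal.K n F (m + 1))) = QuotientGroup.mk h ↔
      (g : GL (OddOrthogonal.Idx n) F)⁻¹ * h ∈ OddOrthogonal.J n F m := fun g h => by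
    rw [QuotientGroup.eq, Subgroup.mem_subgroupOf]
    exact OddOrthogonal.mem_K_inf_iff hϖ (g⁻¹ * h).2
  refine ⟨hmem, ?_, ?_⟩
  · rintro ⟨⟨S, hS⟩, z⟩ ⟨⟨S', hS'⟩, z'⟩ h
    have h0 := (hcoset ⟨_, hmem ⟨⟨S, hS⟩, z⟩⟩ ⟨_, hmem ⟨⟨S', hS'⟩, z'⟩⟩).1 h
    obtain ⟨h1, h2⟩ := OddOrthogonal.eq_of_inv_mul_rep_mem_J hϖ h0
    obtain rfl : S = S' := h1
    simp only [hlift] at h2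
    obtain rfl : z = z' := OddOrthogonal.altMat_injective h2
    rfl
  · intro q
    obtain ⟨g, rfl⟩ := QuotientGroup.mk_surjective q
    obtain ⟨S, z, hz⟩ := OddOrthogonal.exists_inv_rep_mul_mem_J hϖ g.2.1
    obtain ⟨y, hy⟩ : ∃ y : OddOrthogonal.rootSet S → 𝒪[F],
        ∀ β, IsLocalRing.residue 𝒪[F] (y β) = z β :=
      ⟨fun β => (IsLocalRing.residue_surjective (z β)).choose,
        fun β => (IsLocalRing.residue_surjective (z β)).choose_spec⟩
    have hS := OddOrthogonal.even_card_of_mem_K hϖ g.2 (hz y hy)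
    exact ⟨⟨⟨S, hS⟩, z⟩,
      (hcoset ⟨_, hmem ⟨⟨S, hS⟩, z⟩⟩ g).2 (hz _ (hlift ⟨⟨S, hS⟩, z⟩))⟩
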